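/- Let $\mathbb{D}=\{z\in\mathbb{C}:|z|<1\}$ and $d\iota(z)=\dfrac{dz}{\pi(1-|z|^2)^2}$, where $dz$ is Lebesgue measure. For an integer $\nu\ge 2$ let $d\iota_\nu(z)=(\nu-1)(1-|z|^2)^\nu\,d\iota(z)$, and let $\mathcal{H}_\nu$ be the Hilbert space of holomorphic functions on $\mathbb{D}$ that are square integrable for $d\iota_\nu$, with the inner product of $L^2(\mathbb{D},d\iota_\nu)$ and reproducing kernel $K^\nu(x,y)=(1-x\bar y)^{-\nu}$; write $K^\nu_y=K^\nu(\cdot,y)$. For a bounded operator $A$ on $\mathcal{H}_\nu$ with kernel $A(x,y)=(AK^\nu_y)(x)$ put $R_\nu(A)(z)=A(z,z)(1-|z|^2)^\nu$. This defines a map $R_\nu$ from the Hilbert-Schmidt operators $S^2(\mathcal{H}_\nu)$ to $L^2(\mathbb{D},d\iota)$, and it has an adjoint $R_\nu^*$: for $f\in L^2(\mathbb{D},d\iota)$ as in (1) or (2) below, $R_\nu^*(f)\in S^2(\mathcal{H}_\nu)$ and $\langle R_\nu^*(f),B\rangle_{S^2}=\langle f,R_\nu(B)\rangle_{L^2(\mathbb{D},d\iota)}$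 for all $B\in S^2(\mathcal{H}_\nu)$. (1) Let $f\in L^2(\mathbb{D},d\iota)$ be (essentially) bounded and complex valued. Then for every integer $n\ge1$ the operators $((\nu-1)R_\nu^*(f))^{2n}$, $\nu\ge2$, are of trace class, $f^{2n}$ is $\iota$-integrable, and $$\lim_{\nu\to\infty}\frac{1}{\nu-1}\operatorname{Tr}\Big(\big((\nu-1)R_\nu^*(f)\big)^{2n}\Big)=\int_{\mathbb{D}}f(z)^{2n}\,d\iota(z).$$ (2) Let $f\in C_c(\mathbb{D})$ be complex valued. Then for every integer $n\ge1$ the operators $((\nu-1)R_\nu^*(f))^{n}$, $\nu\ge2$, are of trace class, $f^{n}$ is $\iota$-integrable, and $$\lim_{\nu\to\infty}\frac{1}{\nu-1}\operatorname{Tr}\Big(\big((\nu-1)R_\nu^*(f)\big)^{n}\Big)=\int_{\mathbb{D}}f(z)^{n}\,d\iota(z).$$ The limits are over integers $\nu$. -/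

import Mathlib

open MeasureTheory Filter Topology Metric
open scoped ENNReal InnerProductSpace ComplexConjugate

noncomputable section

namespace HolDisc

/-! ### Measures on the unit disc -/

/-- The invariant measure `dι(z) = dz / (π (1 - |z|²)²)` on the open unit disc. -/
def iota : Measure ℂ :=
  (volume.restrict (ball (0 : ℂ) 1)).withDensity
    fun z => ENNReal.ofReal (1 / (Real.pi * (1 - ‖z‖ ^ 2) ^ 2))

/-- The density `(ν - 1) (1 - |z|²)^ν / (π (1 - |z|²)²)` of `dι_ν`. -/
def weight (ν : ℕ) (z : ℂ) : ℝ :=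
  ((ν : ℝ) - 1) * (1 - ‖z‖ ^ 2) ^ ν / (Real.pi * (1 - ‖z‖ ^ 2) ^ 2)

/-- The probability measure `dι_ν(z) = (ν - 1) (1 - |z|²)^ν dz / (π (1 - |z|²)²)` on the open
unit disc (for `ν ≥ 2`). -/
def iotaW (ν : ℕ) : Measure ℂ :=
  (volume.restrict (ball (0 : ℂ) 1)).withDensity fun z => ENNReal.ofReal (weight ν z)

/-! ### The holomorphic discrete series space -/

/-- The space `H_ν` of holomorphic functions on the unit disc which are square integrable for
`dι_ν`, with the inner product of `L²(dι_ν)`: the classes in `L²(dι_ν)` with a representative that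
is holomorphic on the disc. -/
def Hol (ν : ℕ) : Submodule ℂ (Lp ℂ 2 (iotaW ν)) where
  carrier := {h | ∃ g : ℂ → ℂ, DifferentiableOn ℂ g (ball 0 1) ∧ h =ᵐ[iotaW ν] g}
  zero_mem' := ⟨0, differentiableOn_const 0, Lp.coeFn_zero ℂ 2 (iotaW ν)⟩
  add_mem' := by
    rintro a b ⟨g, hg, hag⟩ ⟨k, hk, hbk⟩
    exact ⟨g + k, hg.add hk, (Lp.coeFn_add a b).trans (hag.add hbk)⟩
  smul_mem' := by
    rintro c a ⟨g, hg, hag⟩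
    exact ⟨c • g, hg.const_smul c, (Lp.coeFn_smul c a).trans (hag.const_smul c)⟩

/-- The holomorphic function on the disc given by an element of `H_ν` (only its values on the disc
are meaningful). -/
def toFun {ν : ℕ} (h : Hol ν) : ℂ → ℂ := h.2.choose

lemma toFun_differentiableOn {ν : ℕ} (h : Hol ν) : DifferentiableOn ℂ (toFun h) (ball 0 1) :=
  h.2.choose_spec.1

lemma coe_ae_eq_toFun {ν : ℕ} (h : Hol ν) : (h : Lp ℂ 2 (iotaW ν)) =ᵐ[iotaW ν] toFun h :=
  h.2.choose_spec.2

lemma iotaW_eq_zero {ν : ℕ} (hν : ν < 2) : iotaW ν = 0 := by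
  have h1 : (ν : ℝ) - 1 ≤ 0 := by
    have : (ν : ℝ) ≤ 1 := by exact_mod_cast (by omega : ν ≤ 1)
    linarith
  rw [iotaW, withDensity_eq_zero_iff (by unfold weight; fun_prop)]
  rw [Filter.EventuallyEq, ae_restrict_iff' measurableSet_ball]
  refine Eventually.of_forall fun z hz => ?_
  have hz' : ‖z‖ < 1 := by simpa using hz
  have : 0 < 1 - ‖z‖ ^ 2 := by nlinarith [norm_nonneg z]
  simp only [Pi.zero_apply, ENNReal.ofReal_eq_zero]
  unfold weight
  apply div_nonpos_of_nonpos_of_nonneg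
  · exact mul_nonpos_of_nonpos_of_nonneg h1 (by positivity)
  · have := Real.pi_pos
    positivity

lemma ae_iotaW_mem_ball (ν : ℕ) : ∀ᵐ z ∂(iotaW ν), z ∈ ball (0 : ℂ) 1 :=
  (withDensity_absolutelyContinuous _ _).ae_le (ae_restrict_mem measurableSet_ball)

/-! ### Completeness of `H_ν` -/

lemma norm_le_circle {g : ℂ → ℂ} {z : ℂ} {r ρ : ℝ} (hg : DifferentiableOn ℂ g (ball z r))
    (hρ : 0 < ρ) (hρr : ρ < r) :
    ENNReal.ofReal (2 * Real.pi * ‖g z‖) ≤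
      ∫⁻ θ in Set.Ioo (-Real.pi) Real.pi,
        ENNReal.ofReal ‖g (z + Complex.polarCoord.symm (ρ, θ))‖ := by
  have hsub : closedBall z ρ ⊆ ball z r := closedBall_subset_ball hρr
  have hd : DiffContOnCl ℂ g (ball z |ρ|) := by
    rw [abs_of_pos hρ]
    exact (hg.mono hsub).diffContOnCl_ball le_rfl
  have hav := hd.circleAverage
  have hcont : Continuous fun θ : ℝ => g (circleMap z ρ θ) := by
    refine (hg.continuousOn.mono hsub).comp_continuous (continuous_circleMap z ρ) fun θ => ?_
    exact sphere_subset_closedBall (circleMap_mem_sphere z hρ.le θ)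
  rw [Real.circleAverage_eq_integral_add (-Real.pi),
    intervalIntegral.integral_comp_add_right (fun θ => g (circleMap z ρ θ))] at hav
  have e : 2 * Real.pi + -Real.pi = Real.pi := by ring
  rw [zero_add, e] at hav
  have hpi := Real.pi_pos
  have h1 : 2 * Real.pi * ‖g z‖ ≤ ∫ θ in (-Real.pi)..Real.pi, ‖g (circleMap z ρ θ)‖ := by
    rw [← hav, norm_smul, norm_inv, Real.norm_of_nonneg (by positivity : 0 ≤ 2 * Real.pi),
      mul_inv_cancel_left₀ (by positivity)]
    exact intervalIntegral.norm_integral_le_integral_norm (by linarith)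
  rw [intervalIntegral.integral_of_le (by linarith), integral_Ioc_eq_integral_Ioo] at h1
  refine (ENNReal.ofReal_le_ofReal h1).trans ?_
  rw [ofReal_integral_eq_lintegral_ofReal]
  · refine le_of_eq (lintegral_congr fun θ => ?_)
    simp only [circleMap, Complex.polarCoord_symm_apply, Complex.exp_mul_I, Complex.ofReal_cos,
      Complex.ofReal_sin]
  · exact (hcont.norm.continuousOn.integrableOn_Icc
      (a := -Real.pi) (b := Real.pi)).mono_set Set.Ioo_subset_Icc_self
  · exact Eventually.of_forall fun θ => norm_nonneg _

lemma norm_le_area {g : ℂ → ℂ} {z : ℂ} {r : ℝ} (hr : 0 < r)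
    (hg : DifferentiableOn ℂ g (ball z r)) :
    ENNReal.ofReal (r / 2) * (ENNReal.ofReal (r / 2) * ENNReal.ofReal (2 * Real.pi * ‖g z‖)) ≤
      ∫⁻ w in ball z r, ENNReal.ofReal ‖g w‖ := by
  classical
  set F : ℂ → ℝ≥0∞ := (ball z r).indicator fun w => ENNReal.ofReal ‖g w‖ with hF
  have hFm : Measurable F := by
    rw [hF, ← Set.piecewise_eq_indicator]
    refine ContinuousOn.measurable_piecewise ?_ continuousOn_const measurableSet_ball
    exact ENNReal.continuous_ofReal.comp_continuousOn hg.continuousOn.norm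
  have hsymm : Measurable fun p : ℝ × ℝ => Complex.polarCoord.symm p := by
    simp only [Complex.polarCoord_symm_apply]
    fun_prop
  have hm : Measurable fun p : ℝ × ℝ =>
      ENNReal.ofReal p.1 • F (z + Complex.polarCoord.symm p) := by
    simp only [smul_eq_mul]
    exact (ENNReal.measurable_ofReal.comp measurable_fst).mul
      (hFm.comp (measurable_const.add hsymm))
  calc _ = ∫⁻ _ in Set.Ioo (r / 2) r,
        (ENNReal.ofReal (r / 2) * ENNReal.ofReal (2 * Real.pi * ‖g z‖)) := by
        rw [setLIntegral_const, Real.volume_Ioo, mul_comm]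
        congr 2
        ring
    _ ≤ ∫⁻ ρ in Set.Ioo (r / 2) r, ∫⁻ θ in Set.Ioo (-Real.pi) Real.pi,
        ENNReal.ofReal ρ • F (z + Complex.polarCoord.symm (ρ, θ)) := by
        refine setLIntegral_mono' measurableSet_Ioo fun ρ hρ => ?_
        have hρ0 : 0 < ρ := lt_trans (by positivity) hρ.1
        have : Measurable fun θ : ℝ => F (z + Complex.polarCoord.symm (ρ, θ)) :=
          hFm.comp (measurable_const.add (hsymm.comp measurable_prodMk_left))
        simp only [smul_eq_mul]
        rw [lintegral_const_mul _ this]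
        refine mul_le_mul' (ENNReal.ofReal_le_ofReal hρ.1.le) ?_
        refine (norm_le_circle hg hρ0 hρ.2).trans (le_of_eq (lintegral_congr fun θ => ?_))
        rw [hF, Set.indicator_of_mem]
        rw [mem_ball, dist_eq_norm, add_sub_cancel_left, Complex.norm_polarCoord_symm,
          abs_of_pos hρ0]
        exact hρ.2
    _ ≤ ∫⁻ ρ in Set.Ioi (0 : ℝ), ∫⁻ θ in Set.Ioo (-Real.pi) Real.pi,
        ENNReal.ofReal ρ • F (z + Complex.polarCoord.symm (ρ, θ)) :=
        lintegral_mono_set fun ρ hρ => lt_trans (by positivity : 0 < r / 2) hρ.1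
    _ = ∫⁻ p in polarCoord.target, ENNReal.ofReal p.1 • F (z + Complex.polarCoord.symm p) := by
        rw [polarCoord_target, Measure.volume_eq_prod, ← Measure.prod_restrict,
          lintegral_prod _ hm.aemeasurable]
    _ = ∫⁻ w, F (z + w) := Complex.lintegral_comp_polarCoord_symm fun w => F (z + w)
    _ = ∫⁻ w, F w := lintegral_add_left_eq_self F z
    _ = _ := by rw [hF, lintegral_indicator measurableSet_ball]

lemma weight_lower {ν : ℕ} (hν : 2 ≤ ν) {R : ℝ} (hR0 : 0 ≤ R) (hR : R < 1) {w : ℂ}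
    (hw : ‖w‖ ≤ R) : (1 - R ^ 2) ^ ν / Real.pi ≤ weight ν w := by
  have hpi := Real.pi_pos
  have h2 : (2 : ℝ) ≤ ν := by exact_mod_cast hν
  have h3 : ‖w‖ ^ 2 ≤ R ^ 2 := by gcongr
  have h4 : 0 < 1 - R ^ 2 := by nlinarith
  have h5 : 0 < 1 - ‖w‖ ^ 2 := by linarith
  have h6 : (1 - ‖w‖ ^ 2) ^ 2 ≤ 1 := pow_le_one₀ h5.le (by nlinarith [sq_nonneg ‖w‖])
  unfold weight
  rw [div_le_div_iff₀ hpi (by positivity)]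
  have h7 : (1 - R ^ 2) ^ ν ≤ (1 - ‖w‖ ^ 2) ^ ν := by gcongr
  calc (1 - R ^ 2) ^ ν * (Real.pi * (1 - ‖w‖ ^ 2) ^ 2)
      ≤ (1 - ‖w‖ ^ 2) ^ ν * (Real.pi * 1) := by gcongr
    _ = 1 * (1 - ‖w‖ ^ 2) ^ ν * Real.pi := by ring
    _ ≤ ((ν : ℝ) - 1) * (1 - ‖w‖ ^ 2) ^ ν * Real.pi := by gcongr; linarith

lemma weight_upper {ν : ℕ} (hν : 2 ≤ ν) {w : ℂ} (hw : ‖w‖ < 1) :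
    weight ν w ≤ ν / Real.pi := by
  have hpi := Real.pi_pos
  have h2 : (2 : ℝ) ≤ ν := by exact_mod_cast hν
  have h5 : 0 < 1 - ‖w‖ ^ 2 := by nlinarith [norm_nonneg w]
  have h6 : (1 - ‖w‖ ^ 2) ^ ν ≤ (1 - ‖w‖ ^ 2) ^ 2 :=
    pow_le_pow_of_le_one h5.le (by nlinarith [sq_nonneg ‖w‖]) hν
  unfold weight
  rw [div_le_div_iff₀ (by positivity) hpi]
  have : ((ν : ℝ) - 1) * (1 - ‖w‖ ^ 2) ^ ν ≤ ν * (1 - ‖w‖ ^ 2) ^ 2 := by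
    gcongr
    linarith
  nlinarith

lemma measurable_weight (ν : ℕ) : Measurable (weight ν) := by
  unfold weight
  fun_prop

instance isFiniteMeasure_iotaW (ν : ℕ) : IsFiniteMeasure (iotaW ν) := by
  by_cases hν : ν < 2
  · rw [iotaW_eq_zero hν]; infer_instance
  · refine ⟨?_⟩
    rw [iotaW, withDensity_apply _ MeasurableSet.univ, Measure.restrict_univ]
    calc ∫⁻ z in ball (0 : ℂ) 1, ENNReal.ofReal (weight ν z)
        ≤ ∫⁻ _ in ball (0 : ℂ) 1, ENNReal.ofReal (ν / Real.pi) := by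
          refine setLIntegral_mono' measurableSet_ball fun z hz => ?_
          exact ENNReal.ofReal_le_ofReal (weight_upper (by omega) (by simpa using hz))
      _ < ∞ := by
          rw [setLIntegral_const]
          exact ENNReal.mul_lt_top ENNReal.ofReal_lt_top measure_ball_lt_top

/-- Point evaluations are bounded, uniformly on discs of radius `R < 1`. -/
lemma exists_eval_bound {ν : ℕ} (hν : 2 ≤ ν) {R : ℝ} (hR0 : 0 ≤ R) (hR : R < 1) :
    ∃ C : ℝ, ∀ (h : Lp ℂ 2 (iotaW ν)) (g : ℂ → ℂ), DifferentiableOn ℂ g (ball 0 1) →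
      h =ᵐ[iotaW ν] g → ∀ z : ℂ, ‖z‖ ≤ R → ‖g z‖ ≤ C * ‖h‖ := by
  have hpi := Real.pi_pos
  set R' : ℝ := (1 + R) / 2 with hR'
  set r : ℝ := (1 - R) / 2 with hr
  have hr0 : 0 < r := by rw [hr]; linarith
  have hR'0 : 0 ≤ R' := by rw [hR']; linarith
  have hR'1 : R' < 1 := by rw [hR']; linarith
  set a : ℝ := (1 - R' ^ 2) ^ ν / Real.pi with ha
  have ha0 : 0 < a := by
    have : 0 < 1 - R' ^ 2 := by nlinarith
    positivity
  set c : ℝ := a * ((r / 2) * ((r / 2) * (2 * Real.pi))) with hc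
  have hc0 : 0 < c := by positivity
  refine ⟨Real.sqrt c⁻¹, fun h g hg hhg z hz => ?_⟩
  have hsub : ball z r ⊆ ball 0 1 := by
    intro w hw
    rw [mem_ball_zero_iff]
    rw [mem_ball, dist_eq_norm] at hw
    have := norm_le_norm_add_norm_sub' w z
    rw [hr] at hw
    linarith
  have hsub' : ∀ w ∈ ball z r, ‖w‖ ≤ R' := by
    intro w hw
    rw [mem_ball, dist_eq_norm] at hw
    have := norm_le_norm_add_norm_sub' w z
    rw [hr] at hw
    rw [hR']
    linarith
  have h1 := norm_le_area hr0 ((hg.mono hsub).pow 2)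
  have hnorm : ENNReal.ofReal (‖h‖ ^ 2) = ∫⁻ w, ENNReal.ofReal (‖g w‖ ^ 2) ∂(iotaW ν) := by
    have e1 := eLpNorm_nnreal_pow_eq_lintegral (f := h) (μ := iotaW ν) (p := 2) (by norm_num)
    have e2 : ENNReal.ofReal ‖h‖ = eLpNorm h 2 (iotaW ν) := by
      rw [Lp.norm_def, ENNReal.ofReal_toReal (Lp.eLpNorm_ne_top h)]
    rw [ENNReal.ofReal_pow (norm_nonneg _), e2]
    simp only [NNReal.coe_ofNat, ENNReal.coe_ofNat, ENNReal.rpow_ofNat] at e1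
    rw [e1]
    refine lintegral_congr_ae (hhg.mono fun w hw => ?_)
    simp only [hw]
    rw [ENNReal.ofReal_pow (norm_nonneg _), ofReal_norm]
  have h2 : ENNReal.ofReal a * ∫⁻ w in ball z r, ENNReal.ofReal ‖(g ^ 2) w‖
      ≤ ENNReal.ofReal (‖h‖ ^ 2) := by
    rw [hnorm, iotaW, lintegral_withDensity_eq_lintegral_mul_non_measurable _
      (measurable_weight ν).ennreal_ofReal (Eventually.of_forall fun _ => ENNReal.ofReal_lt_top),
      ← lintegral_const_mul' _ _ ENNReal.ofReal_ne_top]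
    refine (setLIntegral_mono' measurableSet_ball fun w hw => ?_).trans
      (lintegral_mono_set hsub)
    simp only [Pi.mul_apply, Pi.pow_apply, norm_pow]
    exact mul_le_mul' (ENNReal.ofReal_le_ofReal (weight_lower hν hR'0 hR'1 (hsub' w hw))) le_rfl
  have h3 : c * ‖g z‖ ^ 2 ≤ ‖h‖ ^ 2 := by
    have h4 := (mul_le_mul' (le_refl (ENNReal.ofReal a)) h1).trans h2
    rw [← ENNReal.ofReal_mul (by positivity), ← ENNReal.ofReal_mul (by positivity),
      ← ENNReal.ofReal_mul (by positivity), ENNReal.ofReal_le_ofReal_iff (by positivity)] at h4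
    simp only [Pi.pow_apply, norm_pow] at h4
    rw [hc]
    linarith
  rw [← Real.sqrt_sq (norm_nonneg h), ← Real.sqrt_mul (by positivity)]
  refine Real.le_sqrt_of_sq_le ?_
  rw [inv_mul_eq_div, le_div_iff₀ hc0]
  linarith

lemma isClosed_hol (ν : ℕ) : IsClosed (Hol ν : Set (Lp ℂ 2 (iotaW ν))) := by
  by_cases hν : ν < 2
  · have h0 := iotaW_eq_zero hν
    have : (Hol ν : Set (Lp ℂ 2 (iotaW ν))) = Set.univ := by
      refine Set.eq_univ_of_forall fun h => ⟨0, differentiableOn_const 0, ?_⟩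
      have : ae (iotaW ν) = ⊥ := by rw [h0, ae_zero]
      rw [Filter.EventuallyEq, this]
      exact eventually_bot
    rw [this]
    exact isClosed_univ
  replace hν : 2 ≤ ν := by omega
  refine isSeqClosed_iff_isClosed.mp fun F h hF hlim => ?_
  choose g hg hFg using hF
  have hcs : ∀ K ⊆ ball (0 : ℂ) 1, IsCompact K → UniformCauchySeqOn g atTop K := by
    intro K hK hKc
    obtain ⟨R, hR1, hKR⟩ := exists_lt_subset_ball hKc.isClosed hK
    obtain ⟨C, hC⟩ := exists_eval_bound hν (le_max_right R 0) (max_lt hR1 one_pos)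
    rw [Metric.uniformCauchySeqOn_iff]
    intro ε hε
    obtain ⟨N, hN⟩ := Metric.cauchySeq_iff.mp hlim.cauchySeq (ε / (|C| + 1)) (by positivity)
    refine ⟨N, fun m hm n hn z hz => ?_⟩
    have h1 := hC (F m - F n) (g m - g n) ((hg m).sub (hg n))
      ((Lp.coeFn_sub _ _).trans ((hFg m).sub (hFg n))) z
      ((mem_ball_zero_iff.mp (hKR hz)).le.trans (le_max_left _ _))
    have h2 := hN m hm n hn
    rw [dist_eq_norm] at h2 ⊢
    rw [lt_div_iff₀ (by positivity)] at h2
    have h3 : C * ‖F m - F n‖ ≤ |C| * ‖F m - F n‖ := by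
      gcongr
      exact le_abs_self C
    have h4 : ‖g m z - g n z‖ ≤ C * ‖F m - F n‖ := h1
    nlinarith [norm_nonneg (F m - F n)]
  have hpt : ∀ z : ℂ, ∃ w : ℂ, z ∈ ball (0 : ℂ) 1 → Tendsto (fun n => g n z) atTop (𝓝 w) := by
    intro z
    by_cases hz : z ∈ ball (0 : ℂ) 1
    · obtain ⟨w, hw⟩ := cauchySeq_tendsto_of_complete
        ((hcs {z} (Set.singleton_subset_iff.mpr hz) isCompact_singleton).cauchySeq
          (Set.mem_singleton z))
      exact ⟨w, fun _ => hw⟩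
    · exact ⟨0, fun h => absurd h hz⟩
  choose k hk using hpt
  have hloc : TendstoLocallyUniformlyOn g k atTop (ball 0 1) := by
    rw [tendstoLocallyUniformlyOn_iff_forall_isCompact isOpen_ball]
    intro K hK hKc
    exact (hcs K hK hKc).tendstoUniformlyOn_of_tendsto fun z hz => hk z (hK hz)
  refine ⟨k, hloc.differentiableOn (Eventually.of_forall hg) isOpen_ball, ?_⟩
  obtain ⟨ns, hns, hae⟩ := (tendstoInMeasure_of_tendsto_Lp hlim).exists_seq_tendsto_ae
  have hall : ∀ᵐ z ∂(iotaW ν), ∀ n, F n z = g n z := ae_all_iff.mpr hFg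
  filter_upwards [hae, hall, ae_iotaW_mem_ball ν] with z h1 h2 h3
  refine tendsto_nhds_unique h1 ?_
  simp only [h2]
  exact (hk z h3).comp hns.tendsto_atTop

instance completeSpace_hol (ν : ℕ) : CompleteSpace (Hol ν) :=
  (isClosed_hol ν).completeSpace_coe

/-! ### The reproducing kernel -/

/-- The function `x ↦ K^ν(x, y) = (1 - x ȳ)^{-ν}`. -/
def kernelFun (ν : ℕ) (y x : ℂ) : ℂ := ((1 - x * conj y) ^ ν)⁻¹

lemma one_sub_norm_le {x y : ℂ} (hx : ‖x‖ < 1) : 1 - ‖y‖ ≤ ‖1 - x * conj y‖ := by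
  have h1 : ‖x * conj y‖ ≤ ‖y‖ := by
    rw [norm_mul, RCLike.norm_conj]
    exact mul_le_of_le_one_left (norm_nonneg _) hx.le
  have h2 := norm_sub_norm_le (1 : ℂ) (x * conj y)
  rw [norm_one] at h2
  linarith

lemma memLp_kernelFun (ν : ℕ) {y : ℂ} (hy : ‖y‖ < 1) : MemLp (kernelFun ν y) 2 (iotaW ν) := by
  refine MemLp.of_bound (C := ((1 - ‖y‖) ^ ν)⁻¹) ?_ ?_
  · refine Measurable.aestronglyMeasurable ?_
    unfold kernelFun
    fun_prop
  · filter_upwards [ae_iotaW_mem_ball ν] with x hx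
    have h0 : 0 < 1 - ‖y‖ := by linarith
    rw [kernelFun, norm_inv, norm_pow]
    gcongr
    exact one_sub_norm_le (by simpa using hx)

lemma differentiableOn_kernelFun (ν : ℕ) {y : ℂ} (hy : ‖y‖ < 1) :
    DifferentiableOn ℂ (kernelFun ν y) (ball 0 1) := by
  unfold kernelFun
  refine DifferentiableOn.inv (by fun_prop) fun x hx => pow_ne_zero _ ?_
  have := one_sub_norm_le (y := y) (by simpa using hx : ‖x‖ < 1)
  exact norm_pos_iff.mp (by linarith)

/-- The reproducing kernel vector `K_y = K^ν(·, y) ∈ H_ν` for `y` in the disc (and `0` outside). -/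
def kernelVec (ν : ℕ) (y : ℂ) : Hol ν :=
  if hy : ‖y‖ < 1 then
    ⟨(memLp_kernelFun ν hy).toLp, kernelFun ν y, differentiableOn_kernelFun ν hy,
      MemLp.coeFn_toLp _⟩
  else 0

/-! ### Hilbert-Schmidt and trace-class operators -/

section Operators

universe u

/-- The index set of some Hilbert basis of `H`. -/
def basisIndex (H : Type u) [NormedAddCommGroup H] [InnerProductSpace ℂ H] [CompleteSpace H] :
    Set H :=
  (exists_hilbertBasis ℂ H).choose

/-- Some Hilbert basis of `H`. -/
def basis (H : Type u) [NormedAddCommGroup H] [InnerProductSpace ℂ H] [CompleteSpace H] :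
    HilbertBasis (basisIndex H) ℂ H :=
  (exists_hilbertBasis ℂ H).choose_spec.choose

variable {H : Type u} [NormedAddCommGroup H] [InnerProductSpace ℂ H] [CompleteSpace H]

/-- `A` is Hilbert-Schmidt, `A ∈ S²(H)`: `∑ ‖A e_i‖² < ∞` (this does not depend on the basis). -/
def IsHilbertSchmidt (A : H →L[ℂ] H) : Prop :=
  Summable fun i => ‖A (basis H i)‖ ^ 2

/-- The inner product `⟨A, B⟩ = Tr(A* B)` of `S²(H)`, conjugate linear in `A`. -/
def hsInner (A B : H →L[ℂ] H) : ℂ :=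
  ∑' i, ⟪A (basis H i), B (basis H i)⟫_ℂ

/-- `A` is of trace class, `A ∈ S¹(H)`: its trace norm, the supremum of `∑ |⟨v_i, A w_i⟩|` over all
finite orthonormal systems `v` and `w` of the same length, is finite. -/
def IsTraceClass (A : H →L[ℂ] H) : Prop :=
  ∃ C : ℝ, ∀ (m : ℕ) (v w : Fin m → H), Orthonormal ℂ v → Orthonormal ℂ w →
    ∑ i, ‖⟪v i, A (w i)⟫_ℂ‖ ≤ C

/-- The trace `∑ ⟨e_i, A e_i⟩` of a trace-class operator (it does not depend on the basis). -/
def trace (A : H →L[ℂ] H) : ℂ :=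
  ∑' i, ⟪basis H i, A (basis H i)⟫_ℂ

end Operators

/-! ### The covariant symbol and its adjoint -/

/-- The kernel `A(x, y) = (A K_y)(x)` of an operator `A` on `H_ν`. -/
def opKernel {ν : ℕ} (A : Hol ν →L[ℂ] Hol ν) (x y : ℂ) : ℂ := toFun (A (kernelVec ν y)) x

/-- The covariant symbol `R_ν(A)(z) = A(z, z) (1 - |z|²)^ν`. -/
def covSymbol {ν : ℕ} (A : Hol ν →L[ℂ] Hol ν) (z : ℂ) : ℂ :=
  opKernel A z z * ((1 - ‖z‖ ^ 2 : ℝ) : ℂ) ^ ν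

/-- `A` is the image of `f` under the Hilbert space adjoint of `R_ν : S²(H_ν) → L²(dι)`, that is
`A ∈ S²(H_ν)` and `⟨A, B⟩_{S²} = ⟨f, R_ν(B)⟩_{L²(dι)}` for all `B ∈ S²(H_ν)`. -/
def IsAdjointSymbol {ν : ℕ} (f : ℂ → ℂ) (A : Hol ν →L[ℂ] Hol ν) : Prop :=
  IsHilbertSchmidt A ∧
    ∀ B : Hol ν →L[ℂ] Hol ν, IsHilbertSchmidt B →
      MemLp (covSymbol B) 2 iota ∧ hsInner A B = ∫ z, conj (f z) * covSymbol B z ∂iota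

open Classical in
/-- `R_ν^*(f)`, the image of `f ∈ L²(dι)` under the adjoint of `R_ν : S²(H_ν) → L²(dι)`. -/
def adjointSymbol (ν : ℕ) (f : ℂ → ℂ) : Hol ν →L[ℂ] Hol ν :=
  if h : ∃ A : Hol ν →L[ℂ] Hol ν, IsAdjointSymbol f A then h.choose else 0

end HolDisc

end

noncomputable section

namespace HolDisc

/-! Let `P` be the orthogonal projection of L²(ι_ν) onto `Hol ν`, `M_g` multiplication by g, and T_g
= P M_g the Toeplitz operator (`toeplitz`). The operator (ν - 1) R_ν^*(f) is T_f
(`smul_adjointSymbol`), so the claim is a semiclassical trace formula: Tr(T_f^m) ~ (ν - 1) ∫ f^m dι.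

Since the kernel on the diagonal is (1 - |z|²)^{-ν}, it cancels the weight of ι_ν. Hence ∑ ⟨e_i, M_F
e_i⟩ = (ν - 1) ∫ F dι exactly (`hasSum_integral_mul_basis`), and the squared Hilbert-Schmidt norm of
M_g on `Hol ν` is (ν - 1) ∫ |g|² dι (`tsum_enorm_mulOp_sq`). What remains is to show that T_f^k
differs from M_{f^k} on `Hol ν` by o(ν - 1) in squared Hilbert-Schmidt norm.

For k = 1 the difference is the Hankel operator M_f - T_f. By Pythagoras its squared norm is (ν - 1)
∫ |f|² dι minus that of T_f, and the latter is at least (ν - 1) ∫ |R_ν(T_f)|² dι, because √(ν - 1)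
R_ν is a contraction (`lintegral_covSymbol_sq_le`). Now R_ν(T_f) is the Berezin transform of f,
which tends to f at points of continuity (`tendsto_covSymbol_toeplitz`), so Fatou's lemma shows that
the Hankel part is negligible when f is continuous almost everywhere. Approximation in L² gives all
bounded square integrable f (`tendsto_hankelRatio`).

Induction on k passes to powers (`tendsto_powRatio`). Finally Tr(T_f^{k+2}) = ∑ ⟨M_{f̄} e_i,
T_f^{k+1} e_i⟩; replacing T_f^{k+1} by M_{f^{k+1}} gives the main term, with an error controlled by
Cauchy-Schwarz (`norm_trace_toeplitz_pow_sub_le`). The first power needs no limit: its normalized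
trace equals the integral as soon as f is integrable. -/

/-- Makes `⟪x, y⟫_ℂ` elaborate to the inner product of an inner product space (rather than that of
a C⋆-module). -/
instance innerOfInnerProductSpace {E : Type*} [NormedAddCommGroup E] [h : InnerProductSpace ℂ E] :
    Inner ℂ E := h.toInner

/-! ### Unfolding the Hilbert-Schmidt inner product and the trace. -/

section Operators

variable {H : Type*} [NormedAddCommGroup H] [InnerProductSpace ℂ H] [CompleteSpace H]

lemma hsInner_def (A B : H →L[ℂ] H) : hsInner A B = ∑' i, ⟪A (basis H i), B (basis H i)⟫_ℂ := rfl

lemma trace_def (A : H →L[ℂ] H) : trace A = ∑' i, ⟪basis H i, A (basis H i)⟫_ℂ := rfl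

lemma hsInner_smul_left (c : ℂ) (A B : H →L[ℂ] H) : hsInner (c • A) B = conj c * hsInner A B := by
  simp only [hsInner_def, smul_apply, inner_smul_left, tsum_mul_left]

end Operators

/-! ### The mean value property for `dι_ν` -/

lemma one_sub_sq_pos {z : ℂ} (hz : ‖z‖ < 1) : 0 < 1 - ‖z‖ ^ 2 := by
  nlinarith [norm_nonneg z]

lemma weight_nonneg {ν : ℕ} (hν : 2 ≤ ν) {z : ℂ} (hz : ‖z‖ < 1) : 0 ≤ weight ν z := by
  have h2 : (2 : ℝ) ≤ ν := by exact_mod_cast hν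
  have := one_sub_sq_pos hz
  have := Real.pi_pos
  unfold weight
  have : (0 : ℝ) ≤ (ν : ℝ) - 1 := by linarith
  positivity

/-- In polar coordinates the density of ι_ν has the primitive -(1 - r²)^{ν-1}; so ι_ν has total mass
one. -/
lemma integral_radial_weight {ν : ℕ} (hν : 2 ≤ ν) :
    ∫ r in Set.Ioo (0 : ℝ) 1, r * (weight ν r * (2 * Real.pi)) = 1 := by
  -- With ν = n + 2 the two powers of 1 - r² in the denominator of `weight` cancel without a
  -- negative exponent.
  obtain ⟨n, rfl⟩ := Nat.exists_eq_add_of_le' hν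
  have hpi := Real.pi_pos
  have h1 : ∀ r ∈ Set.Ioo (0 : ℝ) 1, r * (weight (n + 2) r * (2 * Real.pi)) =
      ((n : ℝ) + 1) * (1 - r ^ 2) ^ n * (2 * r) := by
    intro r hr
    have : 0 < 1 - r ^ 2 := by nlinarith [hr.1, hr.2]
    unfold weight
    rw [Complex.norm_real, Real.norm_eq_abs, sq_abs]
    push_cast
    field_simp
    ring
  rw [setIntegral_congr_fun measurableSet_Ioo h1, ← integral_Ioc_eq_integral_Ioo,
    ← intervalIntegral.integral_of_le zero_le_one]
  have hd : ∀ r ∈ Set.uIcc (0 : ℝ) 1, HasDerivAt (fun r : ℝ => -(1 - r ^ 2) ^ (n + 1))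
      (((n : ℝ) + 1) * (1 - r ^ 2) ^ n * (2 * r)) r := by
    intro r _
    refine ((((hasDerivAt_pow 2 r).const_sub 1).pow (n + 1)).neg).congr_deriv ?_
    push_cast
    ring
  rw [intervalIntegral.integral_eq_sub_of_hasDerivAt hd
    (Continuous.intervalIntegrable (by fun_prop) _ _)]
  simp

/-- Mean value property on circles, over the angular range used by `Complex.polarCoord`. -/
lemma integral_circle_eq {G : ℂ → ℂ} (hG : DifferentiableOn ℂ G (ball 0 1)) {r : ℝ} (h0 : 0 < r)
    (h1 : r < 1) :
    ∫ θ in Set.Ioo (-Real.pi) Real.pi, G (Complex.polarCoord.symm (r, θ)) =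
      (2 * Real.pi) • G 0 := by
  have hpi := Real.pi_pos
  have hd : DiffContOnCl ℂ G (ball 0 |r|) := by
    rw [abs_of_pos h0]
    exact (hG.mono (closedBall_subset_ball h1)).diffContOnCl_ball le_rfl
  have hav := hd.circleAverage
  rw [Real.circleAverage_eq_integral_add (-Real.pi),
    intervalIntegral.integral_comp_add_right (fun θ => G (circleMap 0 r θ))] at hav
  have e : 2 * Real.pi + -Real.pi = Real.pi := by ring
  rw [zero_add, e, intervalIntegral.integral_of_le (by linarith),
    integral_Ioc_eq_integral_Ioo] at hav
  rw [← hav, smul_smul, mul_inv_cancel₀ (by positivity), one_smul]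
  refine integral_congr_ae (Eventually.of_forall fun θ => ?_)
  simp only [circleMap, Complex.polarCoord_symm_apply, Complex.exp_mul_I, Complex.ofReal_cos,
    Complex.ofReal_sin, zero_add]

/-- The weight is radial with total mass one, so averaging over circles first leaves the value at
the centre. -/
lemma integral_weight_smul {ν : ℕ} (hν : 2 ≤ ν) {G : ℂ → ℂ}
    (hG : DifferentiableOn ℂ G (ball 0 1))
    (hi : IntegrableOn (fun w => weight ν w • G w) (ball 0 1)) :
    ∫ w in ball (0 : ℂ) 1, weight ν w • G w = G 0 := by
  classical
  have hpi := Real.pi_pos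
  set F : ℂ → ℂ := (ball (0 : ℂ) 1).indicator fun w => weight ν w • G w with hF
  have hFm : Measurable F := by
    have h1 : Measurable ((ball (0 : ℂ) 1).indicator G) := by
      rw [← Set.piecewise_eq_indicator]
      exact ContinuousOn.measurable_piecewise hG.continuousOn continuousOn_const measurableSet_ball
    have h2 : F = fun w => weight ν w • (ball (0 : ℂ) 1).indicator G w := by
      funext w
      rw [hF, Set.indicator_smul_apply]
    rw [h2]
    exact (measurable_weight ν).smul h1
  have hFi : Integrable F := (integrable_indicator_iff measurableSet_ball).mpr hi
  have hsymm : Measurable fun p : ℝ × ℝ => Complex.polarCoord.symm p := by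
    simp only [Complex.polarCoord_symm_apply]
    fun_prop
  -- Fubini needs integrability in polar coordinates; it comes from the change of variables for the
  -- lower integral of the norm.
  have hpol : IntegrableOn (fun p : ℝ × ℝ => p.1 • F (Complex.polarCoord.symm p))
      polarCoord.target := by
    refine ⟨(measurable_fst.smul (hFm.comp hsymm)).aestronglyMeasurable, ?_⟩
    have h1 := Complex.lintegral_comp_polarCoord_symm fun w => ‖F w‖ₑ
    have h2 : ∫⁻ p in polarCoord.target, ‖p.1 • F (Complex.polarCoord.symm p)‖ₑ =
        ∫⁻ w, ‖F w‖ₑ := by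
      rw [← h1]
      refine setLIntegral_congr_fun polarCoord.open_target.measurableSet fun p hp => ?_
      have hp1 : 0 < p.1 := by
        rw [polarCoord_target] at hp
        exact hp.1
      simp only [enorm_smul, smul_eq_mul]
      rw [Real.enorm_eq_ofReal hp1.le]
    rw [HasFiniteIntegral, h2]
    exact hFi.2
  rw [← integral_indicator measurableSet_ball, ← Complex.integral_comp_polarCoord_symm]
  rw [polarCoord_target] at hpol ⊢
  rw [Measure.volume_eq_prod] at hpol ⊢
  rw [setIntegral_prod _ hpol]
  have hin : ∀ r ∈ Set.Ioi (0 : ℝ), ∫ θ in Set.Ioo (-Real.pi) Real.pi,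
      r • F (Complex.polarCoord.symm (r, θ)) =
      (Set.Ioo (0 : ℝ) 1).indicator (fun r => (r * (weight ν r * (2 * Real.pi))) • G 0) r := by
    intro r hr
    have hr0 : 0 < r := hr
    by_cases h1 : r < 1
    · rw [Set.indicator_of_mem (Set.mem_Ioo.mpr ⟨hr0, h1⟩), integral_smul]
      have : ∀ θ, F (Complex.polarCoord.symm (r, θ)) =
          weight ν r • G (Complex.polarCoord.symm (r, θ)) := by
        intro θ
        have hn : ‖Complex.polarCoord.symm (r, θ)‖ = r := by
          rw [Complex.norm_polarCoord_symm, abs_of_pos hr0]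
        rw [hF, Set.indicator_of_mem (by rw [mem_ball_zero_iff, hn]; exact h1)]
        congr 1
        unfold weight
        rw [hn, Complex.norm_real, Real.norm_of_nonneg hr0.le]
      simp only [this]
      rw [integral_smul, integral_circle_eq hG hr0 h1, smul_smul, smul_smul, mul_assoc]
    · rw [Set.indicator_of_notMem (fun h => h1 h.2)]
      have : ∀ θ, F (Complex.polarCoord.symm (r, θ)) = 0 := by
        intro θ
        rw [hF, Set.indicator_of_notMem]
        rw [mem_ball_zero_iff, Complex.norm_polarCoord_symm, abs_of_pos hr0]
        exact h1
      simp only [this, smul_zero, integral_zero]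
  rw [setIntegral_congr_fun measurableSet_Ioi hin, setIntegral_indicator measurableSet_Ioo,
    Set.inter_eq_right.mpr (fun r hr => hr.1), integral_smul_const, integral_radial_weight hν,
    one_smul]

/-! ### Moebius invariance and the reproducing property -/

/-- The involution `w ↦ (z - w) / (1 - w z̄)` of the disc. -/
def moebius (z w : ℂ) : ℂ := (z - w) / (1 - w * conj z)

lemma one_sub_mul_conj_ne_zero {z w : ℂ} (hz : ‖z‖ < 1) (hw : ‖w‖ < 1) : 1 - w * conj z ≠ 0 := by
  have := one_sub_norm_le (y := z) hw
  exact norm_pos_iff.mp (by linarith)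

/-- This is |1 - w z̄|² - |z - w|² = (1 - |z|²)(1 - |w|²), checked in real and imaginary parts. -/
lemma one_sub_sq_moebius {z w : ℂ} (hz : ‖z‖ < 1) (hw : ‖w‖ < 1) :
    1 - ‖moebius z w‖ ^ 2 = (1 - ‖z‖ ^ 2) * (1 - ‖w‖ ^ 2) / ‖1 - w * conj z‖ ^ 2 := by
  have h0 := one_sub_mul_conj_ne_zero hz hw
  have h1 : 0 < ‖1 - w * conj z‖ ^ 2 := by positivity
  rw [moebius, norm_div, div_pow, eq_div_iff h1.ne', sub_mul, div_mul_cancel₀ _ h1.ne', one_mul]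
  simp only [Complex.sq_norm, Complex.normSq_apply]
  simp
  ring

lemma norm_moebius_lt {z w : ℂ} (hz : ‖z‖ < 1) (hw : ‖w‖ < 1) : ‖moebius z w‖ < 1 := by
  have h0 := one_sub_mul_conj_ne_zero hz hw
  have h := one_sub_sq_moebius hz hw
  have h1 : 0 < 1 - ‖moebius z w‖ ^ 2 := by
    rw [h]
    have := one_sub_sq_pos hz
    have := one_sub_sq_pos hw
    positivity
  nlinarith [norm_nonneg (moebius z w)]

lemma one_sub_moebius_mul_conj {z w : ℂ} (hz : ‖z‖ < 1) (hw : ‖w‖ < 1) :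
    1 - moebius z w * conj z = ((1 - ‖z‖ ^ 2 : ℝ) : ℂ) / (1 - w * conj z) := by
  have h0 := one_sub_mul_conj_ne_zero hz hw
  rw [moebius]
  have : ((1 - ‖z‖ ^ 2 : ℝ) : ℂ) = 1 - z * conj z := by
    rw [Complex.mul_conj, Complex.normSq_eq_norm_sq]
    push_cast
    ring
  rw [this]
  field_simp
  ring

lemma moebius_moebius {z w : ℂ} (hz : ‖z‖ < 1) (hw : ‖w‖ < 1) : moebius z (moebius z w) = w := by
  have h0 := one_sub_mul_conj_ne_zero hz hw
  have h1 := one_sub_mul_conj_ne_zero hz (norm_moebius_lt hz hw)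
  rw [moebius, div_eq_iff h1, moebius]
  field_simp
  ring

lemma image_moebius {z : ℂ} (hz : ‖z‖ < 1) : moebius z '' ball 0 1 = ball 0 1 := by
  apply Set.Subset.antisymm
  · rintro _ ⟨w, hw, rfl⟩
    exact mem_ball_zero_iff.mpr (norm_moebius_lt hz (mem_ball_zero_iff.mp hw))
  · intro w hw
    rw [mem_ball_zero_iff] at hw
    exact ⟨moebius z w, mem_ball_zero_iff.mpr (norm_moebius_lt hz hw), moebius_moebius hz hw⟩

lemma hasDerivAt_moebius {z w : ℂ} (hz : ‖z‖ < 1) (hw : ‖w‖ < 1) :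
    HasDerivAt (moebius z) (-((1 - ‖z‖ ^ 2 : ℝ) : ℂ) / (1 - w * conj z) ^ 2) w := by
  have h0 := one_sub_mul_conj_ne_zero hz hw
  have h := ((hasDerivAt_id w).const_sub z).div
    (((hasDerivAt_id w).mul_const (conj z)).const_sub 1) h0
  refine h.congr_deriv ?_
  have : ((1 - ‖z‖ ^ 2 : ℝ) : ℂ) = 1 - z * conj z := by
    rw [Complex.mul_conj, Complex.normSq_eq_norm_sq]
    push_cast
    ring
  rw [this]
  simp only [id]
  congr 1
  ring

/-- The determinant of multiplication by c on the real plane is the algebra norm of c over ℝ. It is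
the Jacobian of a holomorphic map with derivative c. -/
lemma abs_det_smulRight (c : ℂ) :
    |((ContinuousLinearMap.toSpanSingleton ℂ c).restrictScalars ℝ).det| = ‖c‖ ^ 2 := by
  have h1 : ((ContinuousLinearMap.toSpanSingleton ℂ c).restrictScalars ℝ).det = Complex.normSq c := by
    rw [ContinuousLinearMap.det, ← Algebra.norm_complex_apply, Algebra.norm_apply]
    congr 1
    ext; simp [mul_comm]
  rw [h1, Complex.normSq_eq_norm_sq, abs_of_nonneg (by positivity)]

/-- Change of variables `w ↦ moebius z w`. -/
lemma integral_weight_moebius {z : ℂ} (hz : ‖z‖ < 1) (ν : ℕ) (F : ℂ → ℂ) :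
    (IntegrableOn (fun w => weight ν w • F w) (ball 0 1) →
      IntegrableOn (fun w => weight ν w •
        (((1 - ‖z‖ ^ 2) ^ ν / (‖1 - w * conj z‖ ^ 2) ^ ν) • F (moebius z w))) (ball 0 1)) ∧
    ∫ w in ball (0 : ℂ) 1, weight ν w • F w = ∫ w in ball (0 : ℂ) 1, weight ν w •
        (((1 - ‖z‖ ^ 2) ^ ν / (‖1 - w * conj z‖ ^ 2) ^ ν) • F (moebius z w)) := by
  have hd : ∀ w ∈ ball (0 : ℂ) 1, HasFDerivWithinAt (moebius z)
      ((ContinuousLinearMap.toSpanSingleton ℂ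
        (-((1 - ‖z‖ ^ 2 : ℝ) : ℂ) / (1 - w * conj z) ^ 2)).restrictScalars ℝ) (ball 0 1) w :=
    fun w hw => ((hasDerivAt_moebius hz (mem_ball_zero_iff.mp hw)).hasFDerivAt.restrictScalars
      ℝ).hasFDerivWithinAt
  have hinj : Set.InjOn (moebius z) (ball 0 1) := by
    intro a ha b hb hab
    rw [← moebius_moebius hz (mem_ball_zero_iff.mp ha), hab,
      moebius_moebius hz (mem_ball_zero_iff.mp hb)]
  -- The Jacobian cancels against the factor (1 - |z|²)^{-2} |1 - w z̄|⁴ produced by the denominator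
  -- of `weight` (invariance of ι), so only the ν-th power survives.
  have key : ∀ w ∈ ball (0 : ℂ) 1,
      |((ContinuousLinearMap.toSpanSingleton ℂ
        (-((1 - ‖z‖ ^ 2 : ℝ) : ℂ) / (1 - w * conj z) ^ 2)).restrictScalars ℝ).det| •
        (weight ν (moebius z w) • F (moebius z w)) =
      weight ν w • (((1 - ‖z‖ ^ 2) ^ ν / (‖1 - w * conj z‖ ^ 2) ^ ν) • F (moebius z w)) := by
    intro w hw
    have hw' := mem_ball_zero_iff.mp hw
    have h0 := one_sub_mul_conj_ne_zero hz hw'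
    have h1 := one_sub_sq_pos hz
    have h2 := one_sub_sq_pos hw'
    have h3 : 0 < ‖1 - w * conj z‖ := norm_pos_iff.mpr h0
    have hpi := Real.pi_pos
    rw [abs_det_smulRight, norm_div, norm_neg, Complex.norm_real, Real.norm_of_nonneg h1.le,
      norm_pow, smul_smul, smul_smul]
    congr 1
    unfold weight
    simp only [one_sub_sq_moebius hz hw', div_pow, mul_pow]
    generalize 1 - ‖z‖ ^ 2 = a at *
    generalize 1 - ‖w‖ ^ 2 = b at *
    generalize ‖1 - w * conj z‖ = c at *
    field_simp
  constructor
  · intro h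
    have := integrableOn_image_iff_integrableOn_abs_det_fderiv_smul volume measurableSet_ball hd
      hinj (fun w => weight ν w • F w)
    rw [image_moebius hz] at this
    exact (integrableOn_congr_fun key measurableSet_ball).mp (this.mp h)
  · have := integral_image_eq_integral_abs_det_fderiv_smul volume measurableSet_ball hd
      hinj (fun w => weight ν w • F w)
    rw [image_moebius hz] at this
    rw [this]
    exact setIntegral_congr_fun measurableSet_ball key

lemma integral_iotaW {ν : ℕ} (hν : 2 ≤ ν) (F : ℂ → ℂ) :
    ∫ z, F z ∂(iotaW ν) = ∫ w in ball (0 : ℂ) 1, weight ν w • F w := by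
  rw [iotaW, integral_withDensity_eq_integral_toReal_smul (measurable_weight ν).ennreal_ofReal
    (Eventually.of_forall fun _ => ENNReal.ofReal_lt_top)]
  refine setIntegral_congr_fun measurableSet_ball fun w hw => ?_
  rw [ENNReal.toReal_ofReal (weight_nonneg hν (mem_ball_zero_iff.mp hw))]

lemma integrable_iotaW {ν : ℕ} (hν : 2 ≤ ν) {F : ℂ → ℂ} (hF : Integrable F (iotaW ν)) :
    IntegrableOn (fun w => weight ν w • F w) (ball 0 1) := by
  rw [iotaW, integrable_withDensity_iff_integrable_smul' (measurable_weight ν).ennreal_ofReal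
    (Eventually.of_forall fun _ => ENNReal.ofReal_lt_top)] at hF
  refine (integrableOn_congr_fun (fun w hw => ?_) measurableSet_ball).mp hF
  rw [ENNReal.toReal_ofReal (weight_nonneg hν (mem_ball_zero_iff.mp hw))]

/-- The reproducing property for integrals. -/
lemma integral_conj_kernelFun_mul {ν : ℕ} (hν : 2 ≤ ν) {z : ℂ} (hz : ‖z‖ < 1) {h : ℂ → ℂ}
    (hh : DifferentiableOn ℂ h (ball 0 1))
    (hi : Integrable (fun w => conj (kernelFun ν z w) * h w) (iotaW ν)) :
    ∫ w, conj (kernelFun ν z w) * h w ∂(iotaW ν) = h z := by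
  have h1 := one_sub_sq_pos hz
  obtain ⟨hm1, hm2⟩ := integral_weight_moebius hz ν fun w => conj (kernelFun ν z w) * h w
  have hm1 := hm1 (integrable_iotaW hν hi)
  -- After the substitution the antiholomorphic kernel cancels against the ν-th power factor and
  -- leaves the holomorphic K_z(w). The mean value property then applies, and the value at 0 is
  -- h(z), because `moebius z 0` is z and K_z(0) = 1.
  have key : ∀ w ∈ ball (0 : ℂ) 1, weight ν w •
        (((1 - ‖z‖ ^ 2) ^ ν / (‖1 - w * conj z‖ ^ 2) ^ ν) •
          (conj (kernelFun ν z (moebius z w)) * h (moebius z w))) =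
      weight ν w • (kernelFun ν z w * h (moebius z w)) := by
    intro w hw
    have hw' := mem_ball_zero_iff.mp hw
    have h0 := one_sub_mul_conj_ne_zero hz hw'
    have h0' : conj (1 - w * conj z) ≠ 0 := (map_ne_zero _).mpr h0
    congr 1
    rw [kernelFun, kernelFun, one_sub_moebius_mul_conj hz hw', Complex.real_smul, ← mul_assoc]
    congr 1
    have h2 : ((‖1 - w * conj z‖ ^ 2 : ℝ) : ℂ) = (1 - w * conj z) * conj (1 - w * conj z) := by
      rw [Complex.mul_conj, Complex.normSq_eq_norm_sq]
    have h3 : ((1 - ‖z‖ ^ 2 : ℝ) : ℂ) ≠ 0 := by exact_mod_cast h1.ne'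
    rw [Complex.ofReal_div, Complex.ofReal_pow, Complex.ofReal_pow, h2, map_inv₀, map_pow,
      map_div₀, Complex.conj_ofReal]
    generalize ((1 - ‖z‖ ^ 2 : ℝ) : ℂ) = a at *
    generalize conj (1 - w * conj z) = b at *
    generalize 1 - w * conj z = c at *
    rw [mul_pow, div_pow]
    field_simp
  rw [integral_iotaW hν, hm2, setIntegral_congr_fun measurableSet_ball key,
    integral_weight_smul hν (G := fun w => kernelFun ν z w * h (moebius z w))]
  · simp [kernelFun, moebius]
  · refine (differentiableOn_kernelFun ν hz).mul (hh.comp (fun w hw => ?_) fun w hw => ?_)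
    · exact (hasDerivAt_moebius hz (mem_ball_zero_iff.mp hw)).differentiableAt.differentiableWithinAt
    · exact mem_ball_zero_iff.mpr (norm_moebius_lt hz (mem_ball_zero_iff.mp hw))
  · exact (integrableOn_congr_fun key measurableSet_ball).mp hm1

lemma kernelVec_ae_eq (ν : ℕ) {z : ℂ} (hz : ‖z‖ < 1) :
    (kernelVec ν z : Lp ℂ 2 (iotaW ν)) =ᵐ[iotaW ν] kernelFun ν z := by
  rw [kernelVec, dif_pos hz]
  exact MemLp.coeFn_toLp (memLp_kernelFun ν hz)

/-- The reproducing property of the kernel vectors. -/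
lemma inner_kernelVec {ν : ℕ} (hν : 2 ≤ ν) {z : ℂ} (hz : ‖z‖ < 1) (h : Hol ν) :
    ⟪kernelVec ν z, h⟫_ℂ = toFun h z := by
  have hae : (fun w => ⟪(kernelVec ν z : Lp ℂ 2 (iotaW ν)) w, (h : Lp ℂ 2 (iotaW ν)) w⟫_ℂ)
      =ᵐ[iotaW ν] fun w => conj (kernelFun ν z w) * toFun h w := by
    filter_upwards [kernelVec_ae_eq ν hz, coe_ae_eq_toFun h] with w h1 h2
    rw [h1, h2, RCLike.inner_apply, mul_comm]
  rw [Submodule.coe_inner, L2.inner_def, integral_congr_ae hae]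
  exact integral_conj_kernelFun_mul hν hz (toFun_differentiableOn h)
    ((L2.integrable_inner _ _).congr hae)

/-- `toFun` is a chosen holomorphic representative, so pointwise agreement with the kernel needs
proof: both sides are ⟨K_x, K_y⟩ by the reproducing property. -/
lemma toFun_kernelVec {ν : ℕ} (hν : 2 ≤ ν) {y : ℂ} (hy : ‖y‖ < 1) {x : ℂ} (hx : ‖x‖ < 1) :
    toFun (kernelVec ν y) x = kernelFun ν y x := by
  have hae : (fun w => ⟪(kernelVec ν x : Lp ℂ 2 (iotaW ν)) w,
      (kernelVec ν y : Lp ℂ 2 (iotaW ν)) w⟫_ℂ)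
      =ᵐ[iotaW ν] fun w => conj (kernelFun ν x w) * kernelFun ν y w := by
    filter_upwards [kernelVec_ae_eq ν hx, kernelVec_ae_eq ν hy] with w h1 h2
    rw [h1, h2, RCLike.inner_apply, mul_comm]
  rw [← inner_kernelVec hν hx, Submodule.coe_inner, L2.inner_def, integral_congr_ae hae]
  exact integral_conj_kernelFun_mul hν hx (differentiableOn_kernelFun ν hy)
    ((L2.integrable_inner _ _).congr hae)

lemma norm_kernelVec_sq {ν : ℕ} (hν : 2 ≤ ν) {z : ℂ} (hz : ‖z‖ < 1) :
    ‖kernelVec ν z‖ ^ 2 = ((1 - ‖z‖ ^ 2) ^ ν)⁻¹ := by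
  have h1 : ((‖kernelVec ν z‖ ^ 2 : ℝ) : ℂ) = (((1 - ‖z‖ ^ 2) ^ ν)⁻¹ : ℝ) := by
    have := inner_self_eq_norm_sq_to_K (𝕜 := ℂ) (kernelVec ν z)
    rw [inner_kernelVec hν hz, toFun_kernelVec hν hz hz, kernelFun, Complex.mul_conj,
      Complex.normSq_eq_norm_sq] at this
    push_cast at this ⊢
    exact this.symm
  exact_mod_cast h1

/-! ### Multiplication operators on `L²` -/

section MulOp

variable {α : Type*} [MeasurableSpace α] {μ : Measure α} {f : α → ℂ}

/-- Multiplication by an essentially bounded function on `L²`. -/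
def mulOp (hf : MemLp f ∞ μ) : Lp ℂ 2 μ →L[ℂ] Lp ℂ 2 μ :=
  (ContinuousLinearMap.mul ℂ ℂ).holderL μ ∞ 2 2 hf.toLp

lemma mulOp_ae_eq (hf : MemLp f ∞ μ) (h : Lp ℂ 2 μ) :
    mulOp hf h =ᵐ[μ] fun x => f x * h x := by
  have h1 := (ContinuousLinearMap.mul ℂ ℂ).coeFn_holder (r := 2) hf.toLp h
  filter_upwards [h1, hf.coeFn_toLp] with x hx hx'
  rw [← hx']
  exact hx

lemma enorm_sq_eq_lintegral (h : Lp ℂ 2 μ) : ‖h‖ₑ ^ 2 = ∫⁻ x, ‖h x‖ₑ ^ 2 ∂μ := by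
  have e1 := eLpNorm_nnreal_pow_eq_lintegral (f := h) (μ := μ) (p := 2) (by norm_num)
  simp only [NNReal.coe_ofNat, ENNReal.coe_ofNat, ENNReal.rpow_ofNat] at e1
  rw [← e1, Lp.enorm_def]

lemma enorm_mulOp_sq (hf : MemLp f ∞ μ) (h : Lp ℂ 2 μ) :
    ‖mulOp hf h‖ₑ ^ 2 = ∫⁻ x, ‖f x‖ₑ ^ 2 * ‖h x‖ₑ ^ 2 ∂μ := by
  rw [enorm_sq_eq_lintegral]
  refine lintegral_congr_ae ((mulOp_ae_eq hf h).mono fun x hx => ?_)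
  simp only [hx, enorm_mul, mul_pow]

lemma norm_mulOp_le (hf : MemLp f ∞ μ) {C : ℝ} (hC : ∀ᵐ x ∂μ, ‖f x‖ ≤ C) (h : Lp ℂ 2 μ) :
    ‖mulOp hf h‖ ≤ C * ‖h‖ := by
  refine Lp.norm_le_mul_norm_of_ae_le_mul ?_
  filter_upwards [hC, mulOp_ae_eq hf h] with x hx hx'
  rw [hx', norm_mul]
  gcongr

lemma memLp_conj {p : ℝ≥0∞} (hf : MemLp f p μ) : MemLp (fun x => conj (f x)) p μ :=
  hf.star

lemma inner_mulOp_left_eq_integral (hf : MemLp f ∞ μ) (a b : Lp ℂ 2 μ) :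
    ⟪mulOp hf a, b⟫_ℂ = ∫ x, conj (f x * a x) * b x ∂μ := by
  rw [L2.inner_def]
  refine integral_congr_ae ((mulOp_ae_eq hf a).mono fun x hx => ?_)
  simp only [hx, RCLike.inner_apply]
  rw [mul_comm]

lemma inner_mulOp_right_eq_integral (hf : MemLp f ∞ μ) (a b : Lp ℂ 2 μ) :
    ⟪a, mulOp hf b⟫_ℂ = ∫ x, f x * (conj (a x) * b x) ∂μ := by
  rw [L2.inner_def]
  refine integral_congr_ae ((mulOp_ae_eq hf b).mono fun x hx => ?_)
  simp only [hx, RCLike.inner_apply]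
  ring

lemma inner_mulOp_right (hf : MemLp f ∞ μ) (a b : Lp ℂ 2 μ) :
    ⟪a, mulOp hf b⟫_ℂ = ⟪mulOp (memLp_conj hf) a, b⟫_ℂ := by
  rw [inner_mulOp_right_eq_integral, inner_mulOp_left_eq_integral]
  simp only [map_mul, Complex.conj_conj, mul_assoc]

lemma mulOp_mulOp {g : α → ℂ} (hf : MemLp f ∞ μ) (hg : MemLp g ∞ μ)
    (hfg : MemLp (fun x => f x * g x) ∞ μ) (h : Lp ℂ 2 μ) :
    mulOp hf (mulOp hg h) = mulOp hfg h := by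
  refine Lp.ext ?_
  filter_upwards [mulOp_ae_eq hf (mulOp hg h), mulOp_ae_eq hg h, mulOp_ae_eq hfg h]
    with x h1 h2 h3
  rw [h1, h2, h3, mul_assoc]

end MulOp

/-! ### Square summable families -/

lemma summable_norm_sq_iff {ι E : Type*} [NormedAddCommGroup E] {x : ι → E} :
    Summable (fun i => ‖x i‖ ^ 2) ↔ ∑' i, ‖x i‖ₑ ^ 2 ≠ ∞ := by
  have h1 : ∀ i, ‖x i‖ₑ ^ 2 = ((‖x i‖₊ ^ 2 : NNReal) : ℝ≥0∞) := fun i => by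
    rw [enorm_eq_nnnorm, ENNReal.coe_pow]
  simp only [h1]
  rw [ENNReal.tsum_coe_ne_top_iff_summable, ← NNReal.summable_coe]
  simp

lemma ofReal_tsum_norm_sq {ι E : Type*} [NormedAddCommGroup E] {x : ι → E}
    (h : Summable (fun i => ‖x i‖ ^ 2)) :
    ENNReal.ofReal (∑' i, ‖x i‖ ^ 2) = ∑' i, ‖x i‖ₑ ^ 2 := by
  rw [ENNReal.ofReal_tsum_of_nonneg (fun i => by positivity) h]
  refine tsum_congr fun i => ?_
  rw [ENNReal.ofReal_pow (norm_nonneg _), ofReal_norm]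

lemma hasSum_norm_inner_sq {ι E : Type*} [NormedAddCommGroup E] [InnerProductSpace ℂ E]
    (b : HilbertBasis ι ℂ E) (x : E) : HasSum (fun i => ‖⟪x, b i⟫_ℂ‖ ^ 2) (‖x‖ ^ 2) := by
  have h := (b.hasSum_inner_mul_inner x x).mapL Complex.reCLM
  have h1 : Complex.reCLM ⟪x, x⟫_ℂ = ‖x‖ ^ 2 := by
    rw [inner_self_eq_norm_sq_to_K]
    simp [← Complex.ofReal_pow]
  rw [h1] at h
  refine h.congr_fun fun i => ?_
  rw [← inner_conj_symm (b i) x, Complex.reCLM_apply]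
  rw [Complex.mul_conj, Complex.ofReal_re, Complex.normSq_eq_norm_sq]

lemma tsum_enorm_inner_sq {ι E : Type*} [NormedAddCommGroup E] [InnerProductSpace ℂ E]
    (b : HilbertBasis ι ℂ E) (x : E) : ∑' i, ‖⟪x, b i⟫_ℂ‖ₑ ^ 2 = ‖x‖ₑ ^ 2 := by
  have h := hasSum_norm_inner_sq b x
  rw [← ofReal_tsum_norm_sq h.summable, h.tsum_eq, ENNReal.ofReal_pow (norm_nonneg _), ofReal_norm]

/-! ### The measures `ι` and `ι_ν` -/

lemma measurable_iota_density :
    Measurable fun z : ℂ => ENNReal.ofReal (1 / (Real.pi * (1 - ‖z‖ ^ 2) ^ 2)) := by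
  fun_prop

lemma iotaW_eq_withDensity (ν : ℕ) :
    iotaW ν = iota.withDensity fun z => ENNReal.ofReal (((ν : ℝ) - 1) * (1 - ‖z‖ ^ 2) ^ ν) := by
  rw [iotaW, iota, ← withDensity_mul _ measurable_iota_density (by fun_prop)]
  refine withDensity_congr_ae ?_
  filter_upwards [ae_restrict_mem measurableSet_ball] with z hz
  have := one_sub_sq_pos (mem_ball_zero_iff.mp hz)
  have := Real.pi_pos
  rw [Pi.mul_apply, ← ENNReal.ofReal_mul (by positivity)]
  congr 1
  unfold weight
  ring

lemma ae_iota_mem_ball : ∀ᵐ z ∂iota, z ∈ ball (0 : ℂ) 1 :=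
  (withDensity_absolutelyContinuous _ _).ae_le (ae_restrict_mem measurableSet_ball)

lemma iotaW_absolutelyContinuous (ν : ℕ) : iotaW ν ≪ iota := by
  rw [iotaW_eq_withDensity ν]
  exact withDensity_absolutelyContinuous _ _

lemma iota_absolutelyContinuous {ν : ℕ} (hν : 2 ≤ ν) : iota ≪ iotaW ν := by
  rw [iotaW_eq_withDensity ν]
  refine withDensity_absolutelyContinuous' (by fun_prop) ?_
  filter_upwards [ae_iota_mem_ball] with z hz
  have := one_sub_sq_pos (mem_ball_zero_iff.mp hz)
  have h2 : (2 : ℝ) ≤ ν := by exact_mod_cast hν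
  have : 0 < (ν : ℝ) - 1 := by linarith
  rw [Ne, ENNReal.ofReal_eq_zero, not_le]
  positivity

lemma lintegral_iotaW (ν : ℕ) (F : ℂ → ℝ≥0∞) :
    ∫⁻ z, F z ∂(iotaW ν) =
      ∫⁻ z, ENNReal.ofReal (((ν : ℝ) - 1) * (1 - ‖z‖ ^ 2) ^ ν) * F z ∂iota := by
  rw [iotaW_eq_withDensity ν, lintegral_withDensity_eq_lintegral_mul_non_measurable _
    (by fun_prop) (Eventually.of_forall fun _ => ENNReal.ofReal_lt_top)]
  rfl

lemma integral_iotaW_eq_integral_iota {ν : ℕ} (hν : 2 ≤ ν) (F : ℂ → ℂ) :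
    ∫ z, F z ∂(iotaW ν) = ∫ z, (((ν : ℝ) - 1) * (1 - ‖z‖ ^ 2) ^ ν) • F z ∂iota := by
  have h2 : (2 : ℝ) ≤ ν := by exact_mod_cast hν
  rw [iotaW_eq_withDensity ν, integral_withDensity_eq_integral_toReal_smul
    (by fun_prop) (Eventually.of_forall fun _ => ENNReal.ofReal_lt_top)]
  refine integral_congr_ae (ae_iota_mem_ball.mono fun z hz => ?_)
  have := one_sub_sq_pos (mem_ball_zero_iff.mp hz)
  have : 0 < (ν : ℝ) - 1 := by linarith
  simp only
  rw [ENNReal.toReal_ofReal (by positivity)]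

lemma memLp_top_iotaW (ν : ℕ) {f : ℂ → ℂ} (hf : MemLp f ∞ iota) :
    MemLp f ∞ (iotaW ν) := by
  refine ⟨hf.1.mono_ac (iotaW_absolutelyContinuous ν), ?_⟩
  rw [eLpNorm_exponent_top]
  have h := hf.2
  rw [eLpNorm_exponent_top] at h
  exact (eLpNormEssSup_mono_measure f (iotaW_absolutelyContinuous ν)).trans_lt h

/-! ### Bases of `H_ν` -/

/-- Orthonormal vectors have mutual distance √2, so balls of radius 1/2 around them are disjoint,
and L² is separable. Countability permits exchanging sums over the basis with integrals. -/
instance countable_basisIndex (ν : ℕ) : Countable (basisIndex (Hol ν)) := by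
  have : Fact ((2 : ℝ≥0∞) ≠ ∞) := ⟨by norm_num⟩
  have : SecondCountableTopology (Lp ℂ 2 (iotaW ν)) := inferInstance
  have ho := (basis (Hol ν)).orthonormal
  have hd : Pairwise (Function.onFun Disjoint fun i => ball (basis (Hol ν) i) (1 / 2)) := by
    intro i j hij
    refine ball_disjoint_ball ?_
    have h1 : ‖basis (Hol ν) i - basis (Hol ν) j‖ ^ 2 = 2 := by
      rw [@norm_sub_sq ℂ, ho.1, ho.1, ho.2 hij]
      norm_num
    rw [dist_eq_norm]
    nlinarith [norm_nonneg (basis (Hol ν) i - basis (Hol ν) j)]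
  exact hd.countable_of_isOpen_disjoint (fun i => isOpen_ball)
    fun i => ⟨_, mem_ball_self (by norm_num)⟩

lemma enorm_sq_eq_lintegral_toFun {ν : ℕ} (h : Hol ν) :
    ‖h‖ₑ ^ 2 = ∫⁻ z, ‖toFun h z‖ₑ ^ 2 ∂(iotaW ν) := by
  have h1 : ‖h‖ₑ = ‖(h : Lp ℂ 2 (iotaW ν))‖ₑ := rfl
  rw [h1, enorm_sq_eq_lintegral]
  exact lintegral_congr_ae ((coe_ae_eq_toFun h).mono fun z hz => by simp only [hz])

lemma aestronglyMeasurable_toFun {ν : ℕ} (h : Hol ν) :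
    AEStronglyMeasurable (toFun h) (iotaW ν) :=
  (Lp.aestronglyMeasurable _).congr (coe_ae_eq_toFun h)

/-- Parseval for the vector A* K_z, whose inner products with the basis are the values (A e_i)(z).
-/
lemma tsum_enorm_toFun_sq {ν : ℕ} (hν : 2 ≤ ν) (A : Hol ν →L[ℂ] Hol ν) {z : ℂ} (hz : ‖z‖ < 1) :
    ∑' i, ‖toFun (A (basis (Hol ν) i)) z‖ₑ ^ 2 =
      ‖ContinuousLinearMap.adjoint A (kernelVec ν z)‖ₑ ^ 2 := by
  rw [← tsum_enorm_inner_sq (basis (Hol ν))]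
  refine tsum_congr fun i => ?_
  rw [ContinuousLinearMap.adjoint_inner_left, inner_kernelVec hν hz]

lemma enorm_kernelVec_sq {ν : ℕ} (hν : 2 ≤ ν) {z : ℂ} (hz : ‖z‖ < 1) :
    ‖kernelVec ν z‖ₑ ^ 2 = ENNReal.ofReal (((1 - ‖z‖ ^ 2) ^ ν)⁻¹) := by
  rw [← norm_kernelVec_sq hν hz, ENNReal.ofReal_pow (norm_nonneg _), ofReal_norm]

lemma tsum_enorm_toFun_basis_sq {ν : ℕ} (hν : 2 ≤ ν) {z : ℂ} (hz : ‖z‖ < 1) :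
    ∑' i, ‖toFun (basis (Hol ν) i) z‖ₑ ^ 2 = ENNReal.ofReal (((1 - ‖z‖ ^ 2) ^ ν)⁻¹) := by
  rw [← enorm_kernelVec_sq hν hz, ← tsum_enorm_inner_sq (basis (Hol ν))]
  exact tsum_congr fun i => by rw [inner_kernelVec hν hz]

/-- Bessel's inequality for K_z. Finite orthonormal systems are what `IsTraceClass` tests. -/
lemma sum_enorm_toFun_sq_le {ν : ℕ} (hν : 2 ≤ ν) {z : ℂ} (hz : ‖z‖ < 1) {m : ℕ}
    {w : Fin m → Hol ν} (hw : Orthonormal ℂ w) :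
    ∑ i, ‖toFun (w i) z‖ₑ ^ 2 ≤ ENNReal.ofReal (((1 - ‖z‖ ^ 2) ^ ν)⁻¹) := by
  rw [← norm_kernelVec_sq hν hz]
  refine le_trans (le_of_eq ?_)
    (ENNReal.ofReal_le_ofReal (hw.sum_inner_products_le (kernelVec ν z) (s := Finset.univ)))
  rw [ENNReal.ofReal_sum_of_nonneg fun i _ => by positivity]
  refine Finset.sum_congr rfl fun i _ => ?_
  rw [ENNReal.ofReal_pow (norm_nonneg _), norm_inner_symm, inner_kernelVec hν hz, ofReal_norm]

/-- K^ν(z, z) dι_ν(z) = (ν - 1) dι(z): the source of the factor ν - 1 in the trace and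
Hilbert-Schmidt formulas. -/
lemma lintegral_mul_reproducing {ν : ℕ} (hν : 2 ≤ ν) (F : ℂ → ℝ≥0∞) :
    ∫⁻ z, F z * ENNReal.ofReal (((1 - ‖z‖ ^ 2) ^ ν)⁻¹) ∂(iotaW ν) =
      ENNReal.ofReal ((ν : ℝ) - 1) * ∫⁻ z, F z ∂iota := by
  have h2 : (2 : ℝ) ≤ ν := by exact_mod_cast hν
  rw [lintegral_iotaW ν, ← lintegral_const_mul' _ _ ENNReal.ofReal_ne_top]
  refine lintegral_congr_ae (ae_iota_mem_ball.mono fun z hz => ?_)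
  have := one_sub_sq_pos (mem_ball_zero_iff.mp hz)
  simp only
  rw [mul_comm (F z), ← mul_assoc, ← ENNReal.ofReal_mul (by have : 0 < (ν : ℝ) - 1 := by linarith
                                                            positivity)]
  congr 2
  field_simp

lemma enorm_mulOp_toFun_sq {ν : ℕ} {g : ℂ → ℂ} (hg : MemLp g ∞ (iotaW ν)) (h : Hol ν) :
    ‖mulOp hg h‖ₑ ^ 2 = ∫⁻ z, ‖g z‖ₑ ^ 2 * ‖toFun h z‖ₑ ^ 2 ∂(iotaW ν) := by
  rw [enorm_mulOp_sq]
  exact lintegral_congr_ae ((coe_ae_eq_toFun h).mono fun z hz => by simp only [hz])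

/-- The Hilbert-Schmidt norm of a multiplication operator on `H_ν`. -/
lemma tsum_enorm_mulOp_sq {ν : ℕ} (hν : 2 ≤ ν) {g : ℂ → ℂ} (hg : MemLp g ∞ (iotaW ν)) :
    ∑' i, ‖mulOp hg (basis (Hol ν) i)‖ₑ ^ 2 =
      ENNReal.ofReal ((ν : ℝ) - 1) * ∫⁻ z, ‖g z‖ₑ ^ 2 ∂iota := by
  simp only [enorm_mulOp_toFun_sq]
  have hm : ∀ i, AEMeasurable (fun z => ‖g z‖ₑ ^ 2 * ‖toFun (basis (Hol ν) i) z‖ₑ ^ 2) (iotaW ν) :=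
    fun i => (hg.1.enorm.pow_const 2).mul ((aestronglyMeasurable_toFun _).enorm.pow_const 2)
  rw [← lintegral_tsum hm, ← lintegral_mul_reproducing hν]
  refine lintegral_congr_ae ((ae_iotaW_mem_ball ν).mono fun z hz => ?_)
  simp only
  rw [ENNReal.tsum_mul_left, tsum_enorm_toFun_basis_sq hν (mem_ball_zero_iff.mp hz)]

lemma sum_lintegral_toFun_le {ν : ℕ} (hν : 2 ≤ ν) {F : ℂ → ℝ≥0∞} (hF : AEMeasurable F (iotaW ν))
    {m : ℕ} {w : Fin m → Hol ν} (hw : Orthonormal ℂ w) :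
    ∑ i, ∫⁻ z, F z * ‖toFun (w i) z‖ₑ ^ 2 ∂(iotaW ν) ≤
      ENNReal.ofReal ((ν : ℝ) - 1) * ∫⁻ z, F z ∂iota := by
  have hm : ∀ i, AEMeasurable (fun z => F z * ‖toFun (w i) z‖ₑ ^ 2) (iotaW ν) :=
    fun i => hF.mul ((aestronglyMeasurable_toFun _).enorm.pow_const 2)
  rw [← lintegral_finsetSum' _ fun i _ => hm i, ← lintegral_mul_reproducing hν]
  refine lintegral_mono_ae ((ae_iotaW_mem_ball ν).mono fun z hz => ?_)
  rw [← Finset.mul_sum]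
  gcongr
  exact sum_enorm_toFun_sq_le hν (mem_ball_zero_iff.mp hz) hw

/-! ### Toeplitz operators -/

/-- The Toeplitz operator `h ↦ P (f h)` on `H_ν`. -/
def toeplitz {ν : ℕ} {f : ℂ → ℂ} (hf : MemLp f ∞ (iotaW ν)) : Hol ν →L[ℂ] Hol ν :=
  (Hol ν).orthogonalProjectionOnto ∘L mulOp hf ∘L (Hol ν).subtypeL

lemma toeplitz_apply {ν : ℕ} {f : ℂ → ℂ} (hf : MemLp f ∞ (iotaW ν)) (h : Hol ν) :
    toeplitz hf h = (Hol ν).orthogonalProjectionOnto (mulOp hf h) := rfl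

lemma inner_toeplitz_right {ν : ℕ} {f : ℂ → ℂ} (hf : MemLp f ∞ (iotaW ν)) (a b : Hol ν) :
    ⟪a, toeplitz hf b⟫_ℂ = ⟪(a : Lp ℂ 2 (iotaW ν)), mulOp hf b⟫_ℂ := by
  rw [toeplitz_apply, Submodule.inner_orthogonalProjectionOnto_eq_of_mem_left]

lemma inner_toeplitz_left {ν : ℕ} {f : ℂ → ℂ} (hf : MemLp f ∞ (iotaW ν)) (a b : Hol ν) :
    ⟪toeplitz hf a, b⟫_ℂ = ⟪mulOp hf a, (b : Lp ℂ 2 (iotaW ν))⟫_ℂ := by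
  rw [toeplitz_apply, Submodule.inner_orthogonalProjectionOnto_eq_of_mem_right]

/-- The adjoint of T_f is T_{f̄}, in the form that `isTraceClass_mul_mul` consumes. -/
lemma adjoint_toeplitz_inner {ν : ℕ} {f : ℂ → ℂ} (hf : MemLp f ∞ (iotaW ν)) (a b : Hol ν) :
    ⟪a, toeplitz hf b⟫_ℂ = ⟪toeplitz (memLp_conj hf) a, b⟫_ℂ := by
  rw [inner_toeplitz_right, inner_toeplitz_left, inner_mulOp_right]

lemma norm_toeplitz_le_mulOp {ν : ℕ} {f : ℂ → ℂ} (hf : MemLp f ∞ (iotaW ν)) (h : Hol ν) :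
    ‖toeplitz hf h‖ ≤ ‖mulOp hf (h : Lp ℂ 2 (iotaW ν))‖ :=
  (Hol ν).norm_orthogonalProjectionOnto_apply_le (mulOp hf (h : Lp ℂ 2 (iotaW ν)))

/-! ### The adjoint of the covariant symbol -/

lemma lintegral_enorm_sq_ne_top {α : Type*} [MeasurableSpace α] {μ : Measure α} {f : α → ℂ}
    (hf : MemLp f 2 μ) : ∫⁻ z, ‖f z‖ₑ ^ 2 ∂μ ≠ ∞ := by
  have e1 := eLpNorm_nnreal_pow_eq_lintegral (f := f) (μ := μ) (p := 2) (by norm_num)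
  simp only [NNReal.coe_ofNat, ENNReal.coe_ofNat, ENNReal.rpow_ofNat] at e1
  rw [← e1]
  exact ENNReal.pow_ne_top hf.2.ne

lemma summable_mulOp_sq {ν : ℕ} (hν : 2 ≤ ν) {f : ℂ → ℂ} (hf2 : MemLp f 2 iota)
    (hf : MemLp f ∞ (iotaW ν)) : Summable fun i => ‖mulOp hf (basis (Hol ν) i)‖ ^ 2 := by
  rw [summable_norm_sq_iff, tsum_enorm_mulOp_sq hν]
  exact ENNReal.mul_ne_top ENNReal.ofReal_ne_top (lintegral_enorm_sq_ne_top hf2)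

lemma summable_toeplitz_sq {ν : ℕ} (hν : 2 ≤ ν) {f : ℂ → ℂ} (hf2 : MemLp f 2 iota)
    (hf : MemLp f ∞ (iotaW ν)) : Summable fun i => ‖toeplitz hf (basis (Hol ν) i)‖ ^ 2 :=
  (summable_mulOp_sq hν hf2 hf).of_nonneg_of_le (fun i => by positivity) fun i =>
    pow_le_pow_left₀ (norm_nonneg _) (norm_toeplitz_le_mulOp hf _) 2

lemma covSymbol_eq_inner {ν : ℕ} (hν : 2 ≤ ν) (B : Hol ν →L[ℂ] Hol ν) {z : ℂ} (hz : ‖z‖ < 1) :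
    covSymbol B z = ⟪kernelVec ν z, B (kernelVec ν z)⟫_ℂ * ((1 - ‖z‖ ^ 2 : ℝ) : ℂ) ^ ν := by
  rw [covSymbol, opKernel, inner_kernelVec hν hz]

/-- Parseval for ⟨B* K_z, K_z⟩: it expands the diagonal of the kernel of B in the basis. -/
lemma hasSum_inner_kernelVec {ν : ℕ} (hν : 2 ≤ ν) (B : Hol ν →L[ℂ] Hol ν) {z : ℂ}
    (hz : ‖z‖ < 1) :
    HasSum (fun i => toFun (B (basis (Hol ν) i)) z * conj (toFun (basis (Hol ν) i) z))
      ⟪kernelVec ν z, B (kernelVec ν z)⟫_ℂ := by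
  rw [← ContinuousLinearMap.adjoint_inner_left]
  refine ((basis (Hol ν)).hasSum_inner_mul_inner _ _).congr_fun fun i => ?_
  rw [ContinuousLinearMap.adjoint_inner_left, inner_kernelVec hν hz,
    ← inner_kernelVec hν hz (basis (Hol ν) i), inner_conj_symm]

lemma aestronglyMeasurable_inner_kernelVec {ν : ℕ} (hν : 2 ≤ ν) (B : Hol ν →L[ℂ] Hol ν) :
    AEStronglyMeasurable (fun z => ⟪kernelVec ν z, B (kernelVec ν z)⟫_ℂ) (iotaW ν) := by
  refine aestronglyMeasurable_of_tendsto_ae atTop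
    (f := fun (s : Finset (basisIndex (Hol ν))) z => ∑ i ∈ s,
      toFun (B (basis (Hol ν) i)) z * conj (toFun (basis (Hol ν) i) z)) (fun s => ?_) ?_
  · refine Finset.aestronglyMeasurable_fun_sum s fun i _ => ?_
    exact (aestronglyMeasurable_toFun _).mul (aestronglyMeasurable_toFun _).star
  · exact (ae_iotaW_mem_ball ν).mono fun z hz =>
      hasSum_inner_kernelVec hν B (mem_ball_zero_iff.mp hz)

lemma mul_sq_le_of_le_mul {a b c t : ℝ} (hc : 0 ≤ c) (ht : 0 < t) (h : c ≤ a * b)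
    (hb : b ^ 2 = t⁻¹) : (c * t) ^ 2 ≤ t * a ^ 2 := by
  calc (c * t) ^ 2 ≤ (a * b * t) ^ 2 := by gcongr
    _ = a ^ 2 * b ^ 2 * t ^ 2 := by ring
    _ = t * a ^ 2 := by
      rw [hb]
      field_simp

/-- Cauchy-Schwarz for ⟨B* K_z, K_z⟩; the factor ‖K_z‖² = (1 - |z|²)^{-ν} uses up one of the two
weights. -/
lemma norm_covSymbol_sq_le {ν : ℕ} (hν : 2 ≤ ν) (B : Hol ν →L[ℂ] Hol ν) {z : ℂ} (hz : ‖z‖ < 1) :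
    ‖covSymbol B z‖ ^ 2 ≤
      (1 - ‖z‖ ^ 2) ^ ν * ‖ContinuousLinearMap.adjoint B (kernelVec ν z)‖ ^ 2 := by
  have h0 := one_sub_sq_pos hz
  have h4 := norm_inner_le_norm (𝕜 := ℂ) (ContinuousLinearMap.adjoint B (kernelVec ν z))
    (kernelVec ν z)
  have h5 := norm_kernelVec_sq hν hz
  rw [covSymbol_eq_inner hν B hz, ← ContinuousLinearMap.adjoint_inner_left, norm_mul, norm_pow,
    Complex.norm_real, Real.norm_of_nonneg h0.le]
  exact mul_sq_le_of_le_mul (norm_nonneg _) (pow_pos h0 ν) h4 h5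

/-- Integrating the pointwise bound gives the Hilbert-Schmidt norm by Parseval at each point. The
sharp constant 1 is essential for `hankelRatio_add_le`. -/
lemma lintegral_covSymbol_sq_le {ν : ℕ} (hν : 2 ≤ ν) (B : Hol ν →L[ℂ] Hol ν) :
    ENNReal.ofReal ((ν : ℝ) - 1) * ∫⁻ z, ‖covSymbol B z‖ₑ ^ 2 ∂iota ≤
      ∑' i, ‖B (basis (Hol ν) i)‖ₑ ^ 2 := by
  have h2 : (2 : ℝ) ≤ ν := by exact_mod_cast hν
  have hν1 : 0 < (ν : ℝ) - 1 := by linarith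
  calc ENNReal.ofReal ((ν : ℝ) - 1) * ∫⁻ z, ‖covSymbol B z‖ₑ ^ 2 ∂iota
      ≤ ∫⁻ z, ENNReal.ofReal (((ν : ℝ) - 1) * (1 - ‖z‖ ^ 2) ^ ν) *
        ∑' i, ‖toFun (B (basis (Hol ν) i)) z‖ₑ ^ 2 ∂iota := by
        rw [← lintegral_const_mul' _ _ ENNReal.ofReal_ne_top]
        refine lintegral_mono_ae (ae_iota_mem_ball.mono fun z hz => ?_)
        have hz' := mem_ball_zero_iff.mp hz
        have h0 := one_sub_sq_pos hz'
        rw [tsum_enorm_toFun_sq hν B hz', ENNReal.ofReal_mul hν1.le, mul_assoc]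
        refine mul_le_mul_right ?_ _
        rw [← ofReal_norm, ← ofReal_norm, ← ENNReal.ofReal_pow (norm_nonneg _),
          ← ENNReal.ofReal_pow (norm_nonneg _), ← ENNReal.ofReal_mul (by positivity)]
        exact ENNReal.ofReal_le_ofReal (norm_covSymbol_sq_le hν B hz')
    _ = ∑' i, ‖B (basis (Hol ν) i)‖ₑ ^ 2 := by
        rw [← lintegral_iotaW, lintegral_tsum fun i =>
          (aestronglyMeasurable_toFun _).enorm.pow_const 2]
        exact tsum_congr fun i => (enorm_sq_eq_lintegral_toFun _).symm

lemma aestronglyMeasurable_covSymbol {ν : ℕ} (hν : 2 ≤ ν) (B : Hol ν →L[ℂ] Hol ν) :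
    AEStronglyMeasurable (covSymbol B) iota := by
  have h1 : AEStronglyMeasurable (fun z => ⟪kernelVec ν z, B (kernelVec ν z)⟫_ℂ *
      ((1 - ‖z‖ ^ 2 : ℝ) : ℂ) ^ ν) iota :=
    ((aestronglyMeasurable_inner_kernelVec hν B).mono_ac (iota_absolutelyContinuous hν)).mul
      (Measurable.aestronglyMeasurable (by fun_prop))
  exact h1.congr (ae_iota_mem_ball.mono fun z hz =>
    (covSymbol_eq_inner hν B (mem_ball_zero_iff.mp hz)).symm)

lemma memLp_covSymbol {ν : ℕ} (hν : 2 ≤ ν) {B : Hol ν →L[ℂ] Hol ν} (hB : IsHilbertSchmidt B) :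
    MemLp (covSymbol B) 2 iota := by
  have h2 : (2 : ℝ) ≤ ν := by exact_mod_cast hν
  refine ⟨aestronglyMeasurable_covSymbol hν B, ?_⟩
  have e1 := eLpNorm_nnreal_pow_eq_lintegral (f := covSymbol B) (μ := iota) (p := 2) (by norm_num)
  simp only [NNReal.coe_ofNat, ENNReal.coe_ofNat, ENNReal.rpow_ofNat] at e1
  have h := (lintegral_covSymbol_sq_le hν B).trans_lt (summable_norm_sq_iff.mp hB).lt_top
  rw [← e1] at h
  by_contra hc
  rw [not_lt_top_iff.mp hc, ENNReal.top_pow two_ne_zero, ENNReal.mul_top] at h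
  · exact lt_irrefl _ h
  · rw [Ne, ENNReal.ofReal_eq_zero, not_le]
    linarith

lemma summable_norm_mul_norm {ι E F : Type*} [NormedAddCommGroup E] [NormedAddCommGroup F]
    {x : ι → E} {y : ι → F} (hx : Summable fun i => ‖x i‖ ^ 2) (hy : Summable fun i => ‖y i‖ ^ 2) :
    Summable fun i => ‖x i‖ * ‖y i‖ :=
  (hx.add hy).of_nonneg_of_le (fun i => by positivity) fun i => by
    nlinarith [sq_nonneg (‖x i‖ - ‖y i‖), sq_nonneg (‖x i‖), sq_nonneg (‖y i‖)]

lemma integral_norm_sq {α : Type*} [MeasurableSpace α] {μ : Measure α} (u : Lp ℂ 2 μ) :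
    ∫ x, ‖u x‖ ^ 2 ∂μ = ‖u‖ ^ 2 := by
  rw [integral_eq_lintegral_of_nonneg_ae (Eventually.of_forall fun x => by positivity)
    (((Lp.memLp u).integrable_norm_pow two_ne_zero).aestronglyMeasurable)]
  have h : ∀ x, ENNReal.ofReal (‖u x‖ ^ 2) = ‖u x‖ₑ ^ 2 := fun x => by
    rw [ENNReal.ofReal_pow (norm_nonneg _), ofReal_norm]
  simp only [h]
  rw [← enorm_sq_eq_lintegral, ENNReal.toReal_pow, toReal_enorm]

lemma integral_norm_mul_norm_le {α : Type*} [MeasurableSpace α] {μ : Measure α}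
    (u v : Lp ℂ 2 μ) : ∫ x, ‖u x‖ * ‖v x‖ ∂μ ≤ ‖u‖ ^ 2 + ‖v‖ ^ 2 := by
  have hi : ∀ w : Lp ℂ 2 μ, Integrable (fun x => ‖w x‖ ^ 2) μ := fun w =>
    (Lp.memLp w).integrable_norm_pow two_ne_zero
  rw [← integral_norm_sq u, ← integral_norm_sq v, ← integral_add (hi u) (hi v)]
  refine integral_mono_of_nonneg (Eventually.of_forall fun x => by positivity)
    ((hi u).add (hi v)) (Eventually.of_forall fun x => ?_)
  simp only
  nlinarith [sq_nonneg (‖u x‖ - ‖v x‖), sq_nonneg (‖u x‖), sq_nonneg (‖v x‖)]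

/-- Each ⟨T_f e_i, B e_i⟩ is an integral against ι_ν; exchanging sum and integral produces the
diagonal kernel of B, and ι_ν supplies the weight of `covSymbol` and the factor ν - 1. -/
lemma hsInner_toeplitz {ν : ℕ} (hν : 2 ≤ ν) {f : ℂ → ℂ} (hf2 : MemLp f 2 iota)
    (hf : MemLp f ∞ (iotaW ν)) {B : Hol ν →L[ℂ] Hol ν} (hB : IsHilbertSchmidt B) :
    hsInner (toeplitz hf) B = ((ν : ℂ) - 1) * ∫ z, conj (f z) * covSymbol B z ∂iota := by
  have hin : ∀ i, ⟪toeplitz hf (basis (Hol ν) i), B (basis (Hol ν) i)⟫_ℂ =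
      ∫ z, conj (f z) * (toFun (B (basis (Hol ν) i)) z * conj (toFun (basis (Hol ν) i) z))
        ∂(iotaW ν) := by
    intro i
    rw [inner_toeplitz_left, inner_mulOp_left_eq_integral]
    refine integral_congr_ae ?_
    filter_upwards [coe_ae_eq_toFun (basis (Hol ν) i), coe_ae_eq_toFun (B (basis (Hol ν) i))]
      with z h1 h2
    rw [h1, h2, map_mul]
    ring
  have hint : ∀ i, Integrable (fun z => conj (f z) *
      (toFun (B (basis (Hol ν) i)) z * conj (toFun (basis (Hol ν) i) z))) (iotaW ν) := by
    intro i
    refine (L2.integrable_inner (𝕜 := ℂ) (mulOp hf (basis (Hol ν) i))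
      (B (basis (Hol ν) i) : Lp ℂ 2 (iotaW ν))).congr ?_
    filter_upwards [mulOp_ae_eq hf (basis (Hol ν) i), coe_ae_eq_toFun (basis (Hol ν) i),
      coe_ae_eq_toFun (B (basis (Hol ν) i))] with z h0 h1 h2
    rw [h0, h1, h2, RCLike.inner_apply, map_mul]
    ring
  have hbd : ∀ i, ∫ z, ‖conj (f z) *
      (toFun (B (basis (Hol ν) i)) z * conj (toFun (basis (Hol ν) i) z))‖ ∂(iotaW ν) ≤
      ‖mulOp hf (basis (Hol ν) i)‖ ^ 2 + ‖B (basis (Hol ν) i)‖ ^ 2 := by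
    intro i
    refine le_trans (le_of_eq (integral_congr_ae ?_)) (integral_norm_mul_norm_le
      (mulOp hf (basis (Hol ν) i)) (B (basis (Hol ν) i) : Lp ℂ 2 (iotaW ν)))
    filter_upwards [mulOp_ae_eq hf (basis (Hol ν) i), coe_ae_eq_toFun (basis (Hol ν) i),
      coe_ae_eq_toFun (B (basis (Hol ν) i))] with z h0 h1 h2
    simp only [h0, h1, h2, norm_mul, RCLike.norm_conj]
    ring
  have hsum := hasSum_integral_of_summable_integral_norm hint
    (((summable_mulOp_sq hν hf2 hf).add hB).of_nonneg_of_le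
      (fun i => integral_nonneg fun z => norm_nonneg _) hbd)
  rw [hsInner_def, tsum_congr hin, hsum.tsum_eq]
  have h1 : ∫ z, ∑' i, conj (f z) *
      (toFun (B (basis (Hol ν) i)) z * conj (toFun (basis (Hol ν) i) z)) ∂(iotaW ν) =
      ∫ z, conj (f z) * ⟪kernelVec ν z, B (kernelVec ν z)⟫_ℂ ∂(iotaW ν) := by
    refine integral_congr_ae ((ae_iotaW_mem_ball ν).mono fun z hz => ?_)
    simp only
    rw [tsum_mul_left, (hasSum_inner_kernelVec hν B (mem_ball_zero_iff.mp hz)).tsum_eq]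
  rw [h1, integral_iotaW_eq_integral_iota hν, ← integral_const_mul]
  refine integral_congr_ae (ae_iota_mem_ball.mono fun z hz => ?_)
  simp only
  rw [covSymbol_eq_inner hν B (mem_ball_zero_iff.mp hz), Complex.real_smul]
  push_cast
  ring

lemma isAdjointSymbol_toeplitz {ν : ℕ} (hν : 2 ≤ ν) {f : ℂ → ℂ} (hf2 : MemLp f 2 iota)
    (hf : MemLp f ∞ (iotaW ν)) : IsAdjointSymbol f (((ν : ℂ) - 1)⁻¹ • toeplitz hf) := by
  have h2 : (2 : ℝ) ≤ ν := by exact_mod_cast hν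
  have hν1 : (ν : ℂ) - 1 ≠ 0 := by
    have : (ν : ℝ) - 1 ≠ 0 := by linarith
    exact_mod_cast this
  refine ⟨?_, fun B hB => ⟨memLp_covSymbol hν hB, ?_⟩⟩
  · have := (summable_toeplitz_sq hν hf2 hf).mul_left (‖((ν : ℂ) - 1)⁻¹‖ ^ 2)
    refine this.congr fun i => ?_
    rw [smul_apply, norm_smul, mul_pow]
  · rw [hsInner_smul_left, hsInner_toeplitz hν hf2 hf hB, ← mul_assoc]
    have h3 : conj ((ν : ℂ) - 1)⁻¹ = ((ν : ℂ) - 1)⁻¹ := by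
      simp
    rw [h3, inv_mul_cancel₀ hν1, one_mul]

/-- The difference is Hilbert-Schmidt, so it may be tested against itself; it then has zero
Hilbert-Schmidt norm. This identifies the operator chosen in `adjointSymbol`. -/
lemma IsAdjointSymbol.unique {ν : ℕ} {f : ℂ → ℂ} {A A' : Hol ν →L[ℂ] Hol ν}
    (hA : IsAdjointSymbol f A) (hA' : IsAdjointSymbol f A') : A = A' := by
  have hd : IsHilbertSchmidt (A - A') := by
    refine ((hA.1.mul_left 2).add (hA'.1.mul_left 2)).of_nonneg_of_le
      (fun i => by positivity) fun i => ?_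
    rw [sub_apply]
    have h1 := norm_sub_le (A (basis (Hol ν) i)) (A' (basis (Hol ν) i))
    nlinarith [sq_nonneg (‖A (basis (Hol ν) i)‖ - ‖A' (basis (Hol ν) i)‖), norm_nonneg
      (A (basis (Hol ν) i) - A' (basis (Hol ν) i))]
  have hs : ∀ {C : Hol ν →L[ℂ] Hol ν}, IsHilbertSchmidt C →
      Summable fun i => ⟪C (basis (Hol ν) i), (A - A') (basis (Hol ν) i)⟫_ℂ := fun hC =>
    (summable_norm_mul_norm hC hd).of_norm_bounded fun i => norm_inner_le_norm (𝕜 := ℂ) _ _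
  have h1 : hsInner (A - A') (A - A') = 0 := by
    have h2 : hsInner (A - A') (A - A') = hsInner A (A - A') - hsInner A' (A - A') := by
      rw [hsInner_def, hsInner_def, hsInner_def, ← (hs hA.1).tsum_sub (hs hA'.1)]
      refine tsum_congr fun i => ?_
      rw [← inner_sub_left]
      rfl
    rw [h2, (hA.2 _ hd).2, (hA'.2 _ hd).2, sub_self]
  have h2 : ∑' i, ‖(A - A') (basis (Hol ν) i)‖ ^ 2 = 0 := by
    have : ((∑' i, ‖(A - A') (basis (Hol ν) i)‖ ^ 2 : ℝ) : ℂ) = 0 := by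
      rw [← h1, hsInner_def, Complex.ofReal_tsum]
      refine tsum_congr fun i => ?_
      rw [inner_self_eq_norm_sq_to_K]
      norm_cast
    exact_mod_cast this
  have h3 : ∀ i, (A - A') (basis (Hol ν) i) = 0 := by
    intro i
    have := (hasSum_zero_iff_of_nonneg fun i => by positivity).mp (h2 ▸ hd.hasSum)
    have h4 := congrFun this i
    exact norm_eq_zero.mp (pow_eq_zero_iff two_ne_zero |>.mp h4)
  refine sub_eq_zero.mp (ContinuousLinearMap.ext fun x => ?_)
  have h4 := ((basis (Hol ν)).hasSum_repr x).mapL (A - A')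
  simp only [map_smul, h3, smul_zero] at h4
  exact h4.unique hasSum_zero

lemma isAdjointSymbol_adjointSymbol {ν : ℕ} (hν : 2 ≤ ν) {f : ℂ → ℂ} (hf2 : MemLp f 2 iota)
    (hf : MemLp f ∞ iota) : IsAdjointSymbol f (adjointSymbol ν f) := by
  have h : ∃ A : Hol ν →L[ℂ] Hol ν, IsAdjointSymbol f A :=
    ⟨_, isAdjointSymbol_toeplitz hν hf2 (memLp_top_iotaW ν hf)⟩
  rw [adjointSymbol, dif_pos h]
  exact h.choose_spec

/-- `(ν - 1) R_ν^*(f)` is the Toeplitz operator with symbol `f`. -/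
lemma smul_adjointSymbol {ν : ℕ} (hν : 2 ≤ ν) {f : ℂ → ℂ} (hf2 : MemLp f 2 iota)
    (hf : MemLp f ∞ iota) :
    ((ν : ℂ) - 1) • adjointSymbol ν f = toeplitz (memLp_top_iotaW ν hf) := by
  have h2 : (2 : ℝ) ≤ ν := by exact_mod_cast hν
  have hν1 : (ν : ℂ) - 1 ≠ 0 := by
    have : (ν : ℝ) - 1 ≠ 0 := by linarith
    exact_mod_cast this
  rw [(isAdjointSymbol_adjointSymbol hν hf2 hf).unique
    (isAdjointSymbol_toeplitz hν hf2 (memLp_top_iotaW ν hf)), smul_smul, mul_inv_cancel₀ hν1,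
    one_smul]

/-! ### Trace class operators -/

/-- A product containing two Hilbert-Schmidt factors is of trace class: move `A` to the other side
as its adjoint `A'`, then use ab ≤ a² + b². -/
lemma isTraceClass_mul_mul {H : Type*} [NormedAddCommGroup H] [InnerProductSpace ℂ H]
    {A A' B : H →L[ℂ] H} (X : H →L[ℂ] H) (hadj : ∀ a b, ⟪a, A b⟫_ℂ = ⟪A' a, b⟫_ℂ) {C C' : ℝ}
    (hA : ∀ (m : ℕ) (w : Fin m → H), Orthonormal ℂ w → ∑ i, ‖A' (w i)‖ ^ 2 ≤ C)
    (hB : ∀ (m : ℕ) (w : Fin m → H), Orthonormal ℂ w → ∑ i, ‖B (w i)‖ ^ 2 ≤ C') :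
    IsTraceClass (A * X * B) := by
  refine ⟨‖X‖ * (C + C'), fun m v w hv hw => ?_⟩
  calc ∑ i, ‖⟪v i, (A * X * B) (w i)⟫_ℂ‖
      ≤ ∑ i, ‖X‖ * (‖A' (v i)‖ ^ 2 + ‖B (w i)‖ ^ 2) := by
        refine Finset.sum_le_sum fun i _ => ?_
        have h1 : ⟪v i, (A * X * B) (w i)⟫_ℂ = ⟪A' (v i), X (B (w i))⟫_ℂ := hadj _ _
        have h2 := norm_inner_le_norm (𝕜 := ℂ) (A' (v i)) (X (B (w i)))
        have h3 := X.le_opNorm (B (w i))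
        have h4 : ‖A' (v i)‖ * ‖X (B (w i))‖ ≤ ‖A' (v i)‖ * (‖X‖ * ‖B (w i)‖) := by gcongr
        have h5 : ‖A' (v i)‖ * ‖B (w i)‖ ≤ ‖A' (v i)‖ ^ 2 + ‖B (w i)‖ ^ 2 := by
          nlinarith [sq_nonneg (‖A' (v i)‖ - ‖B (w i)‖), sq_nonneg ‖A' (v i)‖,
            sq_nonneg ‖B (w i)‖]
        have h6 := mul_le_mul_of_nonneg_left h5 (norm_nonneg X)
        have h7 : ‖⟪v i, (A * X * B) (w i)⟫_ℂ‖ ≤ ‖A' (v i)‖ * ‖X (B (w i))‖ := h1 ▸ h2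
        linarith
    _ = ‖X‖ * (∑ i, ‖A' (v i)‖ ^ 2 + ∑ i, ‖B (w i)‖ ^ 2) := by
        rw [← Finset.mul_sum, Finset.sum_add_distrib]
    _ ≤ ‖X‖ * (C + C') := by
        gcongr
        · exact hA m v hv
        · exact hB m w hw

lemma sum_norm_toeplitz_sq_le {ν : ℕ} (hν : 2 ≤ ν) {f : ℂ → ℂ} (hf2 : MemLp f 2 iota)
    (hf : MemLp f ∞ (iotaW ν)) {m : ℕ} {w : Fin m → Hol ν} (hw : Orthonormal ℂ w) :
    ∑ i, ‖toeplitz hf (w i)‖ ^ 2 ≤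
      (ENNReal.ofReal ((ν : ℝ) - 1) * ∫⁻ z, ‖f z‖ₑ ^ 2 ∂iota).toReal := by
  rw [← ENNReal.ofReal_le_iff_le_toReal
    (ENNReal.mul_ne_top ENNReal.ofReal_ne_top (lintegral_enorm_sq_ne_top hf2))]
  refine le_trans ?_ (sum_lintegral_toFun_le hν (hf.1.enorm.pow_const 2) hw)
  rw [ENNReal.ofReal_sum_of_nonneg fun i _ => by positivity]
  refine Finset.sum_le_sum fun i _ => ?_
  rw [← enorm_mulOp_toFun_sq hf, ← ofReal_norm (mulOp hf _), ← ENNReal.ofReal_pow (norm_nonneg _)]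
  exact ENNReal.ofReal_le_ofReal
    (pow_le_pow_left₀ (norm_nonneg _) (norm_toeplitz_le_mulOp hf _) 2)

lemma isTraceClass_toeplitz_pow {ν : ℕ} (hν : 2 ≤ ν) {f : ℂ → ℂ} (hf2 : MemLp f 2 iota)
    (hf : MemLp f ∞ (iotaW ν)) {m : ℕ} (hm : 2 ≤ m) : IsTraceClass (toeplitz hf ^ m) := by
  obtain ⟨k, rfl⟩ := Nat.exists_eq_add_of_le' hm
  have h := isTraceClass_mul_mul (toeplitz hf ^ k) (adjoint_toeplitz_inner hf)
    (fun _ _ hw => sum_norm_toeplitz_sq_le hν (memLp_conj hf2) (memLp_conj hf) hw)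
    (fun _ _ hw => sum_norm_toeplitz_sq_le hν hf2 hf hw)
  rwa [← pow_succ', ← pow_succ] at h

lemma mul_le_sq_add_sq (a b : ℝ≥0∞) : a * b ≤ a ^ 2 + b ^ 2 := by
  rcases le_total a b with h | h
  · calc a * b ≤ b * b := by gcongr
      _ ≤ a ^ 2 + b ^ 2 := by rw [← sq]; exact le_add_self
  · calc a * b ≤ a * a := by gcongr
      _ ≤ a ^ 2 + b ^ 2 := by rw [← sq]; exact le_self_add

lemma inner_toeplitz_eq_integral {ν : ℕ} {f : ℂ → ℂ} (hf : MemLp f ∞ (iotaW ν)) (a b : Hol ν) :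
    ⟪a, toeplitz hf b⟫_ℂ = ∫ z, f z * (conj (toFun a z) * toFun b z) ∂(iotaW ν) := by
  rw [inner_toeplitz_right, inner_mulOp_right_eq_integral]
  refine integral_congr_ae ?_
  filter_upwards [coe_ae_eq_toFun a, coe_ae_eq_toFun b] with z h1 h2
  rw [h1, h2]

/-- With no second factor to share the work, integrability of f is used: |f v̄ w| ≤ |f| (|v|² +
|w|²), and Bessel bounds both sums. -/
lemma isTraceClass_toeplitz {ν : ℕ} (hν : 2 ≤ ν) {f : ℂ → ℂ} (hf1 : Integrable f iota)
    (hf : MemLp f ∞ (iotaW ν)) : IsTraceClass (toeplitz hf) := by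
  set D := ENNReal.ofReal ((ν : ℝ) - 1) * ∫⁻ z, ‖f z‖ₑ ∂iota with hD
  have hD' : D ≠ ∞ := ENNReal.mul_ne_top ENNReal.ofReal_ne_top hf1.2.ne
  refine ⟨(D + D).toReal, fun m v w hv hw => ?_⟩
  have hm : ∀ h : Hol ν, AEMeasurable (fun z => ‖f z‖ₑ * ‖toFun h z‖ₑ ^ 2) (iotaW ν) :=
    fun h => hf.1.enorm.mul ((aestronglyMeasurable_toFun h).enorm.pow_const 2)
  have key : ∀ i, ENNReal.ofReal ‖⟪v i, toeplitz hf (w i)⟫_ℂ‖ ≤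
      ∫⁻ z, ‖f z‖ₑ * ‖toFun (v i) z‖ₑ ^ 2 ∂(iotaW ν) +
        ∫⁻ z, ‖f z‖ₑ * ‖toFun (w i) z‖ₑ ^ 2 ∂(iotaW ν) := by
    intro i
    rw [← lintegral_add_left' (hm _), ofReal_norm, inner_toeplitz_eq_integral]
    refine (enorm_integral_le_lintegral_enorm _).trans (lintegral_mono fun z => ?_)
    rw [← mul_add, enorm_mul, enorm_mul, RCLike.enorm_conj]
    gcongr
    exact mul_le_sq_add_sq _ _
  have h1 : ENNReal.ofReal (∑ i, ‖⟪v i, toeplitz hf (w i)⟫_ℂ‖) ≤ D + D := by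
    rw [ENNReal.ofReal_sum_of_nonneg fun i _ => norm_nonneg _]
    refine (Finset.sum_le_sum fun i _ => key i).trans ?_
    rw [Finset.sum_add_distrib]
    exact add_le_add (sum_lintegral_toFun_le hν hf.1.enorm hv)
      (sum_lintegral_toFun_le hν hf.1.enorm hw)
  exact (ENNReal.ofReal_le_iff_le_toReal (ENNReal.add_ne_top.mpr ⟨hD', hD'⟩)).mp h1

lemma inner_kernelVec_self {ν : ℕ} (hν : 2 ≤ ν) {z : ℂ} (hz : ‖z‖ < 1) :
    ⟪kernelVec ν z, kernelVec ν z⟫_ℂ = (((1 - ‖z‖ ^ 2 : ℝ) : ℂ) ^ ν)⁻¹ := by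
  rw [inner_kernelVec hν hz, toFun_kernelVec hν hz hz, kernelFun, Complex.mul_conj,
    Complex.normSq_eq_norm_sq]
  push_cast
  rfl

/-- The trace formula `∑ ⟨e_i, F e_i⟩ = (ν - 1) ∫ F dι`. -/
lemma hasSum_integral_mul_basis {ν : ℕ} (hν : 2 ≤ ν) {F : ℂ → ℂ} (hF : Integrable F iota) :
    HasSum (fun i => ∫ z, F z * (conj (toFun (basis (Hol ν) i) z) * toFun (basis (Hol ν) i) z)
      ∂(iotaW ν)) (((ν : ℂ) - 1) * ∫ z, F z ∂iota) := by
  have hFm : AEStronglyMeasurable F (iotaW ν) := hF.1.mono_ac (iotaW_absolutelyContinuous ν)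
  have hm : ∀ i, AEStronglyMeasurable (fun z => F z * (conj (toFun (basis (Hol ν) i) z) *
      toFun (basis (Hol ν) i) z)) (iotaW ν) := fun i =>
    hFm.mul ((aestronglyMeasurable_toFun _).star.mul (aestronglyMeasurable_toFun _))
  have hnorm : ∀ i z, ‖F z * (conj (toFun (basis (Hol ν) i) z) * toFun (basis (Hol ν) i) z)‖ₑ =
      ‖F z‖ₑ * ‖toFun (basis (Hol ν) i) z‖ₑ ^ 2 := fun i z => by
    rw [enorm_mul, enorm_mul, RCLike.enorm_conj, sq]
  have htot : ∑' i, ∫⁻ z, ‖F z * (conj (toFun (basis (Hol ν) i) z) *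
      toFun (basis (Hol ν) i) z)‖ₑ ∂(iotaW ν) ≠ ∞ := by
    rw [← lintegral_tsum fun i => (hm i).enorm]
    have : ∫⁻ z, ∑' i, ‖F z * (conj (toFun (basis (Hol ν) i) z) *
        toFun (basis (Hol ν) i) z)‖ₑ ∂(iotaW ν) =
        ENNReal.ofReal ((ν : ℝ) - 1) * ∫⁻ z, ‖F z‖ₑ ∂iota := by
      rw [← lintegral_mul_reproducing hν]
      refine lintegral_congr_ae ((ae_iotaW_mem_ball ν).mono fun z hz => ?_)
      simp only [hnorm]
      rw [ENNReal.tsum_mul_left, tsum_enorm_toFun_basis_sq hν (mem_ball_zero_iff.mp hz)]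
    rw [this]
    exact ENNReal.mul_ne_top ENNReal.ofReal_ne_top hF.2.ne
  have hint := fun i => (⟨hm i, (ENNReal.ne_top_of_tsum_ne_top htot i).lt_top⟩ :
    Integrable (fun z => F z * (conj (toFun (basis (Hol ν) i) z) *
      toFun (basis (Hol ν) i) z)) (iotaW ν))
  have hsum := hasSum_integral_of_summable_integral_norm hint (by
    have := ENNReal.summable_toReal htot
    exact this.congr fun i => (integral_norm_eq_lintegral_enorm (hm i)).symm)
  have hval : ∫ z, ∑' i, F z * (conj (toFun (basis (Hol ν) i) z) *
      toFun (basis (Hol ν) i) z) ∂(iotaW ν) = ((ν : ℂ) - 1) * ∫ z, F z ∂iota := by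
    rw [integral_iotaW_eq_integral_iota hν, ← integral_const_mul]
    refine integral_congr_ae (ae_iota_mem_ball.mono fun z hz => ?_)
    have hz' := mem_ball_zero_iff.mp hz
    have h0 := one_sub_sq_pos hz'
    have h1 := hasSum_inner_kernelVec hν (ContinuousLinearMap.id ℂ (Hol ν)) hz'
    have h2 := h1.tsum_eq
    rw [ContinuousLinearMap.id_apply, inner_kernelVec_self hν hz'] at h2
    simp only [ContinuousLinearMap.id_apply] at h2
    simp only [mul_comm (conj _)]
    rw [tsum_mul_left, h2, Complex.real_smul]
    have h4 : ((1 - ‖z‖ ^ 2 : ℝ) : ℂ) ≠ 0 := by exact_mod_cast h0.ne'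
    rw [Complex.ofReal_mul, Complex.ofReal_pow]
    push_cast at h4 ⊢
    field_simp
  rw [← hval]
  exact hsum

lemma trace_toeplitz {ν : ℕ} (hν : 2 ≤ ν) {f : ℂ → ℂ} (hf1 : Integrable f iota)
    (hf : MemLp f ∞ (iotaW ν)) : trace (toeplitz hf) = ((ν : ℂ) - 1) * ∫ z, f z ∂iota := by
  rw [trace_def, ← (hasSum_integral_mul_basis hν hf1).tsum_eq]
  exact tsum_congr fun i => inner_toeplitz_eq_integral hf _ _

/-! ### The Berezin transform -/

/-- `1 - |φ_z(w)|²`, whose powers are the peak functions at `z` of the Berezin transform. -/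
def peak (z w : ℂ) : ℝ := (1 - ‖z‖ ^ 2) * (1 - ‖w‖ ^ 2) / ‖1 - w * conj z‖ ^ 2

/-- The invariant density of the Berezin transform at `z`. -/
def peakDensity (z w : ℂ) : ℝ := (1 - ‖z‖ ^ 2) ^ 2 / (Real.pi * (‖1 - w * conj z‖ ^ 2) ^ 2)

lemma norm_one_sub_pos {z w : ℂ} (hz : ‖z‖ < 1) (hw : ‖w‖ ≤ 1) : 0 < ‖1 - w * conj z‖ := by
  have h1 : ‖w * conj z‖ ≤ ‖z‖ := by
    rw [norm_mul, RCLike.norm_conj]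
    exact mul_le_of_le_one_left (norm_nonneg _) hw
  have h2 := norm_sub_norm_le (1 : ℂ) (w * conj z)
  rw [norm_one] at h2
  linarith

/-- Shows that `peak z` has its unique maximum 1 at z. The boundary is included because the peak
argument runs on the compact closed disc. -/
lemma one_sub_peak {z w : ℂ} (hz : ‖z‖ < 1) (hw : ‖w‖ ≤ 1) :
    1 - peak z w = ‖z - w‖ ^ 2 / ‖1 - w * conj z‖ ^ 2 := by
  have h := norm_one_sub_pos hz hw
  rw [peak, eq_div_iff (by positivity), sub_mul, div_mul_cancel₀ _ (by positivity), one_mul]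
  simp only [Complex.sq_norm, Complex.normSq_apply]
  simp
  ring

lemma continuousOn_peak {z : ℂ} (hz : ‖z‖ < 1) : ContinuousOn (peak z) (closedBall 0 1) := by
  unfold peak
  refine ContinuousOn.div (by fun_prop) (by fun_prop) fun w hw => ?_
  have := norm_one_sub_pos hz (mem_closedBall_zero_iff.mp hw)
  positivity

lemma continuousOn_peakDensity {z : ℂ} (hz : ‖z‖ < 1) :
    ContinuousOn (peakDensity z) (closedBall 0 1) := by
  unfold peakDensity
  refine ContinuousOn.div (by fun_prop) (by fun_prop) fun w hw => ?_
  have := norm_one_sub_pos hz (mem_closedBall_zero_iff.mp hw)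
  have := Real.pi_pos
  positivity

lemma restrict_ball_eq_restrict_closedBall :
    (volume : Measure ℂ).restrict (ball 0 1) = volume.restrict (closedBall 0 1) := by
  refine Measure.restrict_congr_set ?_
  refine (ball_subset_closedBall.eventuallyLE).antisymm ?_
  rw [ae_le_set, closedBall_sdiff_ball]
  exact Measure.addHaar_sphere volume 0 1

/-- The covariant symbol of T_g is the Berezin transform of g. With ν = n + 2, two powers go into
the fixed density `peakDensity`, so ν enters the integrand only through the n-th power of a fixed
function. -/
lemma covSymbol_toeplitz {n : ℕ} {g : ℂ → ℂ} (hg : MemLp g ∞ (iotaW (n + 2))) {z : ℂ}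
    (hz : ‖z‖ < 1) : covSymbol (toeplitz hg) z =
      ((n : ℂ) + 1) * ∫ w in closedBall 0 1, peak z w ^ n • (peakDensity z w • g w) := by
  have hν : 2 ≤ n + 2 := by omega
  have h1 := one_sub_sq_pos hz
  rw [covSymbol_eq_inner hν _ hz, inner_toeplitz_eq_integral, integral_iotaW hν,
    ← restrict_ball_eq_restrict_closedBall, ← integral_const_mul, ← integral_mul_const]
  refine setIntegral_congr_fun measurableSet_ball fun w hw => ?_
  have hw' := mem_ball_zero_iff.mp hw
  have h2 := one_sub_sq_pos hw'
  have h3 := norm_one_sub_pos hz hw'.le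
  have hpi := Real.pi_pos
  rw [toFun_kernelVec hν hz hw', ← Complex.normSq_eq_conj_mul_self, Complex.normSq_eq_norm_sq,
    kernelFun, norm_inv, norm_pow]
  simp only [Complex.real_smul]
  have key : weight (n + 2) w * ((‖1 - w * conj z‖ ^ (n + 2))⁻¹ ^ 2) * (1 - ‖z‖ ^ 2) ^ (n + 2) =
      ((n : ℝ) + 1) * (peak z w ^ n * peakDensity z w) := by
    unfold weight peak peakDensity
    generalize 1 - ‖z‖ ^ 2 = a at *
    generalize 1 - ‖w‖ ^ 2 = b at *
    generalize ‖1 - w * conj z‖ = c at *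
    push_cast
    rw [div_pow, mul_pow]
    field_simp
    ring
  have key' := congrArg (fun x : ℝ => (x : ℂ) * g w) key
  push_cast at key' ⊢
  linear_combination key'

/-- T_1 is the identity; this normalizes the Berezin transform. -/
lemma covSymbol_toeplitz_one {ν : ℕ} (hν : 2 ≤ ν) (h1 : MemLp (fun _ => (1 : ℂ)) ∞ (iotaW ν))
    {z : ℂ} (hz : ‖z‖ < 1) : covSymbol (toeplitz h1) z = 1 := by
  have h0 := one_sub_sq_pos hz
  have h2 : mulOp h1 (kernelVec ν z : Lp ℂ 2 (iotaW ν)) = kernelVec ν z := by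
    refine Lp.ext ?_
    filter_upwards [mulOp_ae_eq h1 (kernelVec ν z : Lp ℂ 2 (iotaW ν))] with x hx
    rw [hx, one_mul]
  rw [covSymbol_eq_inner hν _ hz, inner_toeplitz_right, h2, ← Submodule.coe_inner,
    inner_kernelVec_self hν hz, inv_mul_cancel₀]
  have h4 : ((1 - ‖z‖ ^ 2 : ℝ) : ℂ) ≠ 0 := by exact_mod_cast h0.ne'
  exact pow_ne_zero _ h4

/-- The Berezin transforms of `g` converge to `g` at the points of continuity. -/
lemma tendsto_covSymbol_toeplitz {g : ℂ → ℂ} (hg : MemLp g ∞ iota) {z : ℂ} (hz : ‖z‖ < 1)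
    (hc : ContinuousAt g z) :
    Tendsto (fun ν => covSymbol (toeplitz (memLp_top_iotaW ν hg)) z) atTop (𝓝 (g z)) := by
  have hone : MemLp (fun _ : ℂ => (1 : ℂ)) ∞ iota := memLp_top_const 1
  have hpi := Real.pi_pos
  have hz0 := one_sub_sq_pos hz
  have hzz := norm_one_sub_pos hz hz.le
  have hpz : peak z z = 1 := by
    have := one_sub_peak hz hz.le
    simp at this
    linarith
  -- Normalized powers of a function with a unique maximum concentrate at that maximum.
  have hlim : ∀ {h : ℂ → ℂ}, MemLp h ∞ iota → ContinuousAt h z →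
      Tendsto (fun n : ℕ => (∫ w in closedBall (0 : ℂ) 1, peak z w ^ n)⁻¹ •
        ∫ w in closedBall (0 : ℂ) 1, peak z w ^ n • (peakDensity z w • h w)) atTop
        (𝓝 (peakDensity z z • h z)) := by
    intro h hh hhc
    refine tendsto_setIntegral_pow_smul_of_unique_maximum_of_isCompact_of_integrableOn
      (isCompact_closedBall 0 1) (continuousOn_peak hz) (fun w hw hwz => ?_) (fun w hw => ?_) ?_ ?_
      ?_ ?_
    · have hw' := mem_closedBall_zero_iff.mp hw
      have h1 := one_sub_peak hz hw'
      have h2 := norm_one_sub_pos hz hw'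
      have h3 : 0 < ‖z - w‖ := norm_pos_iff.mpr (sub_ne_zero.mpr hwz.symm)
      have h4 : 0 < ‖z - w‖ ^ 2 / ‖1 - w * conj z‖ ^ 2 := by positivity
      rw [hpz]
      linarith
    · have hw' := mem_closedBall_zero_iff.mp hw
      have : 0 ≤ 1 - ‖w‖ ^ 2 := by nlinarith [norm_nonneg w]
      unfold peak
      positivity
    · rw [hpz]
      exact one_pos
    · rw [interior_closedBall _ one_ne_zero]
      exact subset_closure (mem_ball_zero_iff.mpr hz)
    · have hfin : IsFiniteMeasure ((volume : Measure ℂ).restrict (closedBall 0 1)) :=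
        ⟨by rw [Measure.restrict_apply_univ]; exact measure_closedBall_lt_top⟩
      have hac : (volume : Measure ℂ).restrict (closedBall 0 1) ≪ iota := by
        rw [← restrict_ball_eq_restrict_closedBall]
        refine withDensity_absolutelyContinuous' measurable_iota_density.aemeasurable ?_
        filter_upwards [ae_restrict_mem measurableSet_ball] with w hw
        have := one_sub_sq_pos (mem_ball_zero_iff.mp hw)
        rw [Ne, ENNReal.ofReal_eq_zero, not_le]
        positivity
      have hhi : Integrable h ((volume : Measure ℂ).restrict (closedBall 0 1)) := by
        refine MemLp.integrable (q := ∞) le_top ⟨hh.1.mono_ac hac, ?_⟩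
        have := hh.2
        rw [eLpNorm_exponent_top] at this ⊢
        exact (eLpNormEssSup_mono_measure h hac).trans_lt this
      exact IntegrableOn.continuousOn_smul (K := closedBall (0 : ℂ) 1) hhi (continuousOn_peakDensity hz) (isCompact_closedBall 0 1)
    · refine ContinuousAt.continuousWithinAt ?_
      have hpc : ContinuousAt (peakDensity z) z := (continuousOn_peakDensity hz).continuousAt
        (mem_of_superset (isOpen_ball.mem_nhds (mem_ball_zero_iff.mpr hz)) ball_subset_closedBall)
      exact hpc.smul hhc
  have hd0 : peakDensity z z ≠ 0 := by
    unfold peakDensity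
    positivity
  -- Dividing by the case of the constant 1 removes both the mass of `peak z ^ n` and the factor
  -- `peakDensity z z`, so neither has to be computed.
  have hq := (hlim hg hc).div (hlim hone continuousAt_const) (by simpa using hd0)
  have hval : peakDensity z z • g z / peakDensity z z • (1 : ℂ) = g z := by
    have : (peakDensity z z : ℂ) ≠ 0 := by exact_mod_cast hd0
    simp only [Complex.real_smul]
    field_simp
  rw [hval] at hq
  rw [← tendsto_add_atTop_iff_nat 2]
  refine hq.congr' ?_
  have hne : ∀ᶠ n : ℕ in atTop, (∫ w in closedBall (0 : ℂ) 1, peak z w ^ n)⁻¹ ≠ 0 := by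
    have hd1 : peakDensity z z • (1 : ℂ) ≠ 0 := by simpa using hd0
    have := (hlim hone continuousAt_const).eventually_ne hd1
    refine this.mono fun n hn h0 => hn ?_
    rw [h0, zero_smul]
  filter_upwards [hne] with n hn
  have hn' : ((∫ w in closedBall (0 : ℂ) 1, peak z w ^ n)⁻¹ : ℝ) ≠ 0 := hn
  have h1 := covSymbol_toeplitz_one (by omega : 2 ≤ n + 2) (memLp_top_iotaW (n + 2) hone) hz
  rw [covSymbol_toeplitz _ hz] at h1 ⊢
  have hn'' : (((∫ w in closedBall (0 : ℂ) 1, peak z w ^ n)⁻¹ : ℝ) : ℂ) ≠ 0 := by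
    exact_mod_cast hn'
  have hint0 : ∫ w in closedBall (0 : ℂ) 1, peak z w ^ n • (peakDensity z w • (1 : ℂ)) ≠ 0 := by
    intro h
    rw [h, mul_zero] at h1
    exact zero_ne_one h1
  simp only [Pi.div_apply, Complex.real_smul] at hint0 h1 hn'' ⊢
  rw [mul_div_mul_left _ _ hn'', div_eq_iff hint0]
  linear_combination (-1 : ℂ) *
    (∫ w in closedBall (0 : ℂ) 1, (peak z w ^ n : ℝ) * ((peakDensity z w : ℂ) * g w)) * h1

/-! ### Hankel operators -/

/-- The normalized squared Hilbert-Schmidt norm of the Hankel operator `h ↦ f h - P (f h)`. -/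
def hankelRatio {f : ℂ → ℂ} (hf : MemLp f ∞ iota) (ν : ℕ) : ℝ≥0∞ :=
  (∑' i, ‖mulOp (memLp_top_iotaW ν hf) (basis (Hol ν) i) -
    (toeplitz (memLp_top_iotaW ν hf) (basis (Hol ν) i) : Lp ℂ 2 (iotaW ν))‖ₑ ^ 2) /
    ENNReal.ofReal ((ν : ℝ) - 1)

lemma ofReal_sub_one_ne_zero {ν : ℕ} (hν : 2 ≤ ν) : ENNReal.ofReal ((ν : ℝ) - 1) ≠ 0 := by
  have h2 : (2 : ℝ) ≤ ν := by exact_mod_cast hν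
  rw [Ne, ENNReal.ofReal_eq_zero, not_le]
  linarith

/-- Pythagoras for the orthogonal projection of f h onto `Hol ν`. -/
lemma enorm_mulOp_sq_eq_add {ν : ℕ} {f : ℂ → ℂ} (hf : MemLp f ∞ (iotaW ν)) (h : Hol ν) :
    ‖mulOp hf (h : Lp ℂ 2 (iotaW ν)) - (toeplitz hf h : Lp ℂ 2 (iotaW ν))‖ₑ ^ 2 +
      ‖toeplitz hf h‖ₑ ^ 2 = ‖mulOp hf (h : Lp ℂ 2 (iotaW ν))‖ₑ ^ 2 := by
  set x := mulOp hf (h : Lp ℂ 2 (iotaW ν)) with hx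
  set y := toeplitz hf h with hy
  have h0 : ⟪x - (y : Lp ℂ 2 (iotaW ν)), (y : Lp ℂ 2 (iotaW ν))⟫_ℂ = 0 := by
    rw [inner_sub_left, ← Submodule.coe_inner, hy, inner_toeplitz_left, sub_self]
  have h1 := norm_add_sq_eq_norm_sq_add_norm_sq_of_inner_eq_zero _ _ h0
  rw [sub_add_cancel] at h1
  have h2 : ‖x‖ ^ 2 = ‖x - (y : Lp ℂ 2 (iotaW ν))‖ ^ 2 + ‖y‖ ^ 2 := by
    rw [sq, sq, sq]
    exact h1
  simp only [← ofReal_norm, ← ENNReal.ofReal_pow (norm_nonneg _)]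
  rw [← ENNReal.ofReal_add (by positivity) (by positivity), h2]

/-- Pythagoras summed over the basis, with the Toeplitz part bounded below by its Berezin transform.
-/
lemma hankelRatio_add_le {f : ℂ → ℂ} (hf : MemLp f ∞ iota) {ν : ℕ} (hν : 2 ≤ ν) :
    hankelRatio hf ν + ∫⁻ z, ‖covSymbol (toeplitz (memLp_top_iotaW ν hf)) z‖ₑ ^ 2 ∂iota ≤
      ∫⁻ z, ‖f z‖ₑ ^ 2 ∂iota := by
  have h0 := ofReal_sub_one_ne_zero hν
  have h1 := lintegral_covSymbol_sq_le hν (toeplitz (memLp_top_iotaW ν hf))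
  have h2 := tsum_enorm_mulOp_sq hν (memLp_top_iotaW ν hf)
  simp only [← enorm_mulOp_sq_eq_add] at h2
  rw [ENNReal.tsum_add] at h2
  rw [hankelRatio, ← ENNReal.mul_le_mul_iff_right h0 ENNReal.ofReal_ne_top, mul_add,
    ENNReal.mul_div_cancel h0 ENNReal.ofReal_ne_top, ← h2]
  gcongr

/-- Hankel operators with almost everywhere continuous symbols. -/
lemma tendsto_hankelRatio_of_ae_continuousAt {f : ℂ → ℂ} (hf2 : MemLp f 2 iota)
    (hf : MemLp f ∞ iota) (hc : ∀ᵐ z ∂iota, ContinuousAt f z) :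
    Tendsto (hankelRatio hf) atTop (𝓝 0) := by
  set a := ∫⁻ z, ‖f z‖ₑ ^ 2 ∂iota with ha
  have ha' : a ≠ ∞ := lintegral_enorm_sq_ne_top hf2
  set y : ℕ → ℝ≥0∞ := fun n =>
    ∫⁻ z, ‖covSymbol (toeplitz (memLp_top_iotaW (n + 2) hf)) z‖ₑ ^ 2 ∂iota with hy
  -- Fatou's lemma, as the Berezin transforms converge to f almost everywhere.
  have hlim : a ≤ liminf y atTop := by
    refine le_trans (le_of_eq ?_) (lintegral_liminf_le' fun n =>
      (aestronglyMeasurable_covSymbol (by omega) _).enorm.pow_const 2)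
    refine lintegral_congr_ae ?_
    filter_upwards [hc, ae_iota_mem_ball] with z hz hz'
    have h1 := (tendsto_add_atTop_iff_nat 2).mpr
      (tendsto_covSymbol_toeplitz hf (mem_ball_zero_iff.mp hz') hz)
    exact ((ENNReal.continuous_pow 2).tendsto _ |>.comp h1.enorm).liminf_eq.symm
  rw [← tendsto_add_atTop_iff_nat 2, ENNReal.tendsto_nhds_zero]
  intro ε hε
  have hle : ∀ n, hankelRatio hf (n + 2) + y n ≤ a := fun n => hankelRatio_add_le hf (by omega)
  by_cases ha0 : a = 0
  · refine Eventually.of_forall fun n => ?_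
    have := (le_self_add).trans (hle n)
    rw [ha0] at this
    exact this.trans zero_le
  · have h1 : a - ε < liminf y atTop :=
      (ENNReal.sub_lt_self ha' ha0 hε.ne').trans_le hlim
    filter_upwards [eventually_lt_of_lt_liminf h1] with n hn
    have h2 := hle n
    by_contra hcon
    rw [not_le] at hcon
    -- If the Hankel term exceeded ε, it would together with `y n` exceed `a`, against `hle`.
    have h3 : a ≤ y n + ε := tsub_le_iff_right.mp hn.le
    have hy : y n ≠ ∞ := ne_top_of_le_ne_top ha' (le_add_self.trans h2)
    have h4 : y n + ε < y n + hankelRatio hf (n + 2) := ENNReal.add_lt_add_left hy hcon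
    rw [add_comm (y n) (hankelRatio hf (n + 2))] at h4
    exact absurd (h3.trans_lt h4) (not_lt.mpr h2)

lemma enorm_add_sq_le {E : Type*} [SeminormedAddCommGroup E] (a b : E) :
    ‖a + b‖ₑ ^ 2 ≤ 2 * ‖a‖ₑ ^ 2 + 2 * ‖b‖ₑ ^ 2 := by
  have h : ‖a + b‖ ^ 2 ≤ 2 * ‖a‖ ^ 2 + 2 * ‖b‖ ^ 2 := by
    have := norm_add_le a b
    nlinarith [sq_nonneg (‖a‖ - ‖b‖), norm_nonneg (a + b)]
  have h' := ENNReal.ofReal_le_ofReal h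
  rw [ENNReal.ofReal_add (by positivity) (by positivity), ENNReal.ofReal_mul (by positivity),
    ENNReal.ofReal_mul (by positivity)] at h'
  simpa only [← ofReal_norm, ← ENNReal.ofReal_pow (norm_nonneg _), ENNReal.ofReal_ofNat] using h'

lemma mulOp_add {α : Type*} [MeasurableSpace α] {μ : Measure α} {f g : α → ℂ} (hf : MemLp f ∞ μ)
    (hg : MemLp g ∞ μ) (hfg : MemLp (f + g) ∞ μ) (h : Lp ℂ 2 μ) :
    mulOp hfg h = mulOp hf h + mulOp hg h := by
  refine Lp.ext ?_
  filter_upwards [mulOp_ae_eq hf h, mulOp_ae_eq hg h, mulOp_ae_eq hfg h,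
    Lp.coeFn_add (mulOp hf h) (mulOp hg h)] with x h1 h2 h3 h4
  rw [h4, Pi.add_apply, h1, h2, h3, Pi.add_apply, add_mul]

/-- The perturbation g costs its L² norm uniformly in ν, which makes approximation in L² possible.
-/
lemma hankelRatio_add_le_two_mul {f g : ℂ → ℂ} (hf : MemLp f ∞ iota) (hg : MemLp g ∞ iota)
    (hfg : MemLp (f + g) ∞ iota) {ν : ℕ} (hν : 2 ≤ ν) :
    hankelRatio hfg ν ≤ 2 * hankelRatio hf ν + 2 * ∫⁻ z, ‖g z‖ₑ ^ 2 ∂iota := by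
  have h1 : hankelRatio hg ν ≤ ∫⁻ z, ‖g z‖ₑ ^ 2 ∂iota :=
    le_self_add.trans (hankelRatio_add_le hg hν)
  refine le_trans ?_ (add_le_add_right (mul_le_mul_right h1 2) _)
  rw [hankelRatio, hankelRatio, hankelRatio, ← mul_div_assoc, ← mul_div_assoc, ← ENNReal.add_div,
    ← ENNReal.tsum_mul_left, ← ENNReal.tsum_mul_left, ← ENNReal.tsum_add]
  refine ENNReal.div_le_div_right (ENNReal.tsum_le_tsum fun i => ?_) _
  refine le_trans (le_of_eq ?_) (enorm_add_sq_le _ _)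
  rw [toeplitz_apply, toeplitz_apply, toeplitz_apply, mulOp_add (memLp_top_iotaW ν hf)
    (memLp_top_iotaW ν hg), map_add, Submodule.coe_add]
  congr 2
  abel

lemma iota_ball_lt_top {R : ℝ} (hR : R < 1) : iota (ball 0 R) < ∞ := by
  have hpi := Real.pi_pos
  rcases le_or_gt R 0 with h0 | h0
  · rw [ball_eq_empty.mpr h0, measure_empty]
    exact ENNReal.zero_lt_top
  have hR2 : 0 < 1 - R ^ 2 := by nlinarith
  rw [iota, withDensity_apply _ measurableSet_ball, Measure.restrict_restrict measurableSet_ball,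
    Set.inter_eq_left.mpr (ball_subset_ball hR.le)]
  calc ∫⁻ z in ball (0 : ℂ) R, ENNReal.ofReal (1 / (Real.pi * (1 - ‖z‖ ^ 2) ^ 2))
      ≤ ∫⁻ _ in ball (0 : ℂ) R, ENNReal.ofReal (1 / (Real.pi * (1 - R ^ 2) ^ 2)) := by
        refine setLIntegral_mono' measurableSet_ball fun z hz => ENNReal.ofReal_le_ofReal ?_
        have hz' := mem_ball_zero_iff.mp hz
        gcongr
    _ < ∞ := by
        rw [setLIntegral_const]
        exact ENNReal.mul_lt_top ENNReal.ofReal_lt_top measure_ball_lt_top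

/-- Dominated convergence along the radii 1 - 1/(n + 1). -/
lemma exists_lintegral_compl_ball_le {F : ℂ → ℝ≥0∞} (hFm : AEMeasurable F iota)
    (hF : ∫⁻ z, F z ∂iota ≠ ∞) {ε : ℝ≥0∞} (hε : ε ≠ 0) :
    ∃ R < 1, ∫⁻ z in (ball 0 R)ᶜ, F z ∂iota ≤ ε := by
  have hlim : Tendsto (fun n : ℕ => ∫⁻ z, ((ball (0 : ℂ) (1 - 1 / ((n : ℝ) + 1)))ᶜ).indicator F z
      ∂iota) atTop (𝓝 (∫⁻ _, 0 ∂iota)) := by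
    refine tendsto_lintegral_of_dominated_convergence' F
      (fun n => hFm.indicator measurableSet_ball.compl)
      (fun n => Eventually.of_forall fun z => Set.indicator_le_self _ _ z) hF ?_
    filter_upwards [ae_iota_mem_ball] with z hz
    have hz' := mem_ball_zero_iff.mp hz
    refine tendsto_const_nhds.congr' ?_
    have h1 := (tendsto_one_div_add_atTop_nhds_zero_nat (𝕜 := ℝ)).eventually_lt_const
      (sub_pos.mpr hz')
    filter_upwards [h1] with n hn
    rw [Set.indicator_of_notMem]
    rw [Set.notMem_compl_iff, mem_ball_zero_iff]
    linarith
  rw [lintegral_zero] at hlim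
  obtain ⟨n, hn⟩ := ((ENNReal.tendsto_nhds_zero.mp hlim) ε (pos_iff_ne_zero.mpr hε)).exists
  refine ⟨1 - 1 / ((n : ℝ) + 1), ?_, ?_⟩
  · have : 0 < 1 / ((n : ℝ) + 1) := by positivity
    linarith
  · rwa [lintegral_indicator measurableSet_ball.compl] at hn

/-- The approximant is a continuous function cut off to a disc of radius R < 1, where ι is finite.
The cut-off creates discontinuities only on the circle of radius R, a null set, so no smooth cut-off
is needed. -/
lemma exists_ae_continuousAt_approx {f : ℂ → ℂ} (hf2 : MemLp f 2 iota) {ε : ℝ≥0∞} (hε : ε ≠ 0) :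
    ∃ g : ℂ → ℂ, MemLp g 2 iota ∧ MemLp g ∞ iota ∧ (∀ᵐ z ∂iota, ContinuousAt g z) ∧
      ∫⁻ z, ‖(f - g) z‖ₑ ^ 2 ∂iota ≤ ε := by
  obtain ⟨R, hR, hfR⟩ := exists_lintegral_compl_ball_le (hf2.1.enorm.pow_const 2)
    (lintegral_enorm_sq_ne_top hf2) (ENNReal.half_pos hε).ne'
  have hfin : IsFiniteMeasure (iota.restrict (ball (0 : ℂ) R)) :=
    ⟨by rw [Measure.restrict_apply_univ]; exact iota_ball_lt_top hR⟩
  obtain ⟨u, huc, hfu, hu, hu2⟩ := (hf2.restrict (ball (0 : ℂ) R)).exists_hasCompactSupport_eLpNorm_sub_le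
    (by norm_num) (ε := (ε / 2) ^ (1 / 2 : ℝ)) (by
      rw [Ne, ENNReal.rpow_eq_zero_iff_of_pos (by norm_num)]
      exact (ENNReal.half_pos hε).ne')
  have hfu' : ∫⁻ z in ball (0 : ℂ) R, ‖(f - u) z‖ₑ ^ 2 ∂iota ≤ ε / 2 := by
    have e1 := eLpNorm_nnreal_pow_eq_lintegral (f := f - u) (μ := iota.restrict (ball (0 : ℂ) R))
      (p := 2) (by norm_num)
    simp only [NNReal.coe_ofNat, ENNReal.coe_ofNat, ENNReal.rpow_ofNat] at e1
    rw [← e1]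
    calc _ ≤ ((ε / 2) ^ (1 / 2 : ℝ)) ^ 2 := by gcongr
      _ = ε / 2 := by
        rw [← ENNReal.rpow_natCast, ← ENNReal.rpow_mul]
        norm_num
  obtain ⟨C, hC⟩ := huc.exists_bound_of_continuous hu
  have hind : MemLp ((ball (0 : ℂ) R).indicator u) 2 iota := by
    rw [memLp_indicator_iff_restrict measurableSet_ball]
    exact hu2
  refine ⟨(ball (0 : ℂ) R).indicator u, hind, ?_, ?_, ?_⟩
  · refine memLp_top_of_bound hind.1 C (Eventually.of_forall fun z => ?_)
    exact (norm_indicator_le_norm_self _ _).trans (hC z)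
  · have hs : iota (sphere (0 : ℂ) R) = 0 :=
      (withDensity_absolutelyContinuous _ _).trans Measure.restrict_le_self.absolutelyContinuous
        (Measure.addHaar_sphere volume 0 R)
    filter_upwards [measure_eq_zero_iff_ae_notMem.mp hs] with z hz
    refine hu.continuousOn.continuousAt_indicator ?_
    exact fun h => hz (frontier_ball_subset_sphere h)
  · rw [← lintegral_add_compl _ (measurableSet_ball (x := (0 : ℂ)) (ε := R)), ← ENNReal.add_halves ε]
    refine add_le_add (le_trans (le_of_eq ?_) hfu') (le_trans (le_of_eq ?_) hfR)
    · refine setLIntegral_congr_fun measurableSet_ball fun z hz => ?_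
      simp only [Pi.sub_apply, Set.indicator_of_mem hz]
    · refine setLIntegral_congr_fun measurableSet_ball.compl fun z hz => ?_
      simp only [Pi.sub_apply, Set.indicator_of_notMem hz, sub_zero]

/-- Hankel operators are negligible in the semiclassical limit. -/
lemma tendsto_hankelRatio {f : ℂ → ℂ} (hf2 : MemLp f 2 iota) (hf : MemLp f ∞ iota) :
    Tendsto (hankelRatio hf) atTop (𝓝 0) := by
  rw [ENNReal.tendsto_nhds_zero]
  intro ε hε
  -- Two error terms, each doubled by `hankelRatio_add_le_two_mul`.
  have hε4 : ε / 4 ≠ 0 := (ENNReal.div_pos hε.ne' (by norm_num)).ne'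
  obtain ⟨g, hg2, hg, hgc, hfg⟩ := exists_ae_continuousAt_approx hf2 hε4
  have h1 := ENNReal.tendsto_nhds_zero.mp (tendsto_hankelRatio_of_ae_continuousAt hg2 hg hgc)
    (ε / 4) (pos_iff_ne_zero.mpr hε4)
  filter_upwards [h1, eventually_ge_atTop 2] with ν hν hν2
  have hs : MemLp (g + (f - g)) ∞ iota := hg.add (hf.sub hg)
  have h2 : hankelRatio hf ν = hankelRatio hs ν := by
    congr 1
    abel
  rw [h2]
  refine (hankelRatio_add_le_two_mul hg (hf.sub hg) hs hν2).trans ?_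
  calc 2 * hankelRatio hg ν + 2 * ∫⁻ z, ‖(f - g) z‖ₑ ^ 2 ∂iota
      ≤ 2 * (ε / 4) + 2 * (ε / 4) := by gcongr
    _ = ε := by
      rw [← add_mul, ← mul_div_assoc, mul_comm, mul_div_assoc]
      norm_num
      rw [ENNReal.div_self (by norm_num) (by norm_num), mul_one]

/-! ### Powers of Toeplitz operators -/

lemma memLp_top_pow {α : Type*} [MeasurableSpace α] {μ : Measure α} {f : α → ℂ}
    (hf : MemLp f ∞ μ) (k : ℕ) : MemLp (fun z => f z ^ k) ∞ μ := by
  induction k with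
  | zero => simpa only [pow_zero] using memLp_top_const (1 : ℂ)
  | succ k ih =>
    simp only [pow_succ]
    exact hf.mul ih

lemma memLp_two_pow {α : Type*} [MeasurableSpace α] {μ : Measure α} {f : α → ℂ}
    (hf2 : MemLp f 2 μ) (hf : MemLp f ∞ μ) (k : ℕ) : MemLp (fun z => f z ^ (k + 1)) 2 μ := by
  simp only [pow_succ]
  exact hf2.mul (memLp_top_pow hf k)

lemma integrable_pow {α : Type*} [MeasurableSpace α] {μ : Measure α} {f : α → ℂ}
    (hf2 : MemLp f 2 μ) (hf : MemLp f ∞ μ) (k : ℕ) : Integrable (fun z => f z ^ (k + 2)) μ := by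
  have h : (fun z => f z ^ (k + 2)) = fun z => f z ^ (k + 1) * f z := by
    funext z
    rw [pow_succ]
  rw [h]
  exact (memLp_two_pow hf2 hf k).integrable_mul hf2

lemma exists_ae_bound {f : ℂ → ℂ} (hf : MemLp f ∞ iota) :
    ∃ C : ℝ, ∀ ν, ∀ᵐ z ∂(iotaW ν), ‖f z‖ ≤ C := by
  refine ⟨(eLpNorm f ∞ iota).toReal, fun ν => ?_⟩
  refine (iotaW_absolutelyContinuous ν).ae_le ?_
  have h := ae_le_eLpNormEssSup (f := f) (μ := iota)
  rw [← eLpNorm_exponent_top] at h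
  filter_upwards [h] with z hz
  rw [← toReal_enorm]
  exact ENNReal.toReal_mono hf.2.ne hz

/-- The normalized squared Hilbert-Schmidt norm of `T_f ^ k - M_{f ^ k}`. -/
def powRatio {f : ℂ → ℂ} (hf : MemLp f ∞ iota) (k ν : ℕ) : ℝ≥0∞ :=
  (∑' i, ‖mulOp (memLp_top_iotaW ν (memLp_top_pow hf k)) (basis (Hol ν) i) -
    ((toeplitz (memLp_top_iotaW ν hf) ^ k) (basis (Hol ν) i) : Lp ℂ 2 (iotaW ν))‖ₑ ^ 2) /
    ENNReal.ofReal ((ν : ℝ) - 1)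

/-- On `Hol ν`, M_{f^{k+1}} - T_f^{k+1} = (M_{f^{k+1}} - T_{f^{k+1}}) + P M_f (M_{f^k} - T_f^k): a
Hankel operator with symbol f^{k+1}, plus the previous difference multiplied by an operator of norm
at most C. -/
lemma enorm_mulOp_pow_sub_le {f : ℂ → ℂ} (hf : MemLp f ∞ iota) (k : ℕ) {ν : ℕ} {C : ℝ}
    (hC : ∀ᵐ z ∂(iotaW ν), ‖f z‖ ≤ C) (h : Hol ν) :
    ‖mulOp (memLp_top_iotaW ν (memLp_top_pow hf (k + 1))) (h : Lp ℂ 2 (iotaW ν)) -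
      ((toeplitz (memLp_top_iotaW ν hf) ^ (k + 1)) h : Lp ℂ 2 (iotaW ν))‖ₑ ^ 2 ≤
    2 * ‖mulOp (memLp_top_iotaW ν (memLp_top_pow hf (k + 1))) (h : Lp ℂ 2 (iotaW ν)) -
      (toeplitz (memLp_top_iotaW ν (memLp_top_pow hf (k + 1))) h : Lp ℂ 2 (iotaW ν))‖ₑ ^ 2 +
    2 * ENNReal.ofReal (C ^ 2) *
      ‖mulOp (memLp_top_iotaW ν (memLp_top_pow hf k)) (h : Lp ℂ 2 (iotaW ν)) -
      ((toeplitz (memLp_top_iotaW ν hf) ^ k) h : Lp ℂ 2 (iotaW ν))‖ₑ ^ 2 := by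
  set F := memLp_top_iotaW ν hf
  set u : Lp ℂ 2 (iotaW ν) := mulOp (memLp_top_iotaW ν (memLp_top_pow hf k)) h with hu
  set y : Hol ν := (toeplitz F ^ k) h with hy
  have h1 : mulOp (memLp_top_iotaW ν (memLp_top_pow hf (k + 1))) (h : Lp ℂ 2 (iotaW ν)) =
      mulOp F u := by
    have hfk : MemLp (fun z => f z * f z ^ k) ∞ (iotaW ν) := by
      simpa only [pow_succ'] using memLp_top_iotaW ν (memLp_top_pow hf (k + 1))
    rw [hu, mulOp_mulOp _ _ hfk]
    simp only [pow_succ']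
  have h2 : (toeplitz F ^ (k + 1)) h = toeplitz F y := by
    rw [pow_succ']
    rfl
  have h3 : toeplitz (memLp_top_iotaW ν (memLp_top_pow hf (k + 1))) h - toeplitz F y =
      (Hol ν).orthogonalProjectionOnto (mulOp F (u - y)) := by
    rw [toeplitz_apply, toeplitz_apply, h1, map_sub, map_sub]
  have h4 : ‖toeplitz (memLp_top_iotaW ν (memLp_top_pow hf (k + 1))) h - toeplitz F y‖ₑ ^ 2 ≤
      ENNReal.ofReal (C ^ 2) * ‖u - (y : Lp ℂ 2 (iotaW ν))‖ₑ ^ 2 := by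
    rw [h3]
    have h5 := ((Hol ν).norm_orthogonalProjectionOnto_apply_le (mulOp F (u - y))).trans
      (norm_mulOp_le F hC _)
    have h6 := pow_le_pow_left₀ (norm_nonneg _) h5 2
    rw [mul_pow] at h6
    simpa only [ENNReal.ofReal_mul (sq_nonneg C), ENNReal.ofReal_pow (norm_nonneg _), ofReal_norm]
      using ENNReal.ofReal_le_ofReal h6
  rw [mul_assoc]
  refine le_trans ?_ (add_le_add_right (mul_le_mul_right h4 2) _)
  refine le_trans (le_of_eq ?_) (enorm_add_sq_le _ ((toeplitz (memLp_top_iotaW ν (memLp_top_pow hf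
    (k + 1))) h - toeplitz F y : Hol ν) : Lp ℂ 2 (iotaW ν)))
  rw [h2, Submodule.coe_sub, sub_add_sub_cancel]

lemma powRatio_succ_le {f : ℂ → ℂ} (hf : MemLp f ∞ iota) (k : ℕ) {ν : ℕ} {C : ℝ}
    (hC : ∀ᵐ z ∂(iotaW ν), ‖f z‖ ≤ C) :
    powRatio hf (k + 1) ν ≤ 2 * hankelRatio (memLp_top_pow hf (k + 1)) ν +
      2 * ENNReal.ofReal (C ^ 2) * powRatio hf k ν := by
  rw [powRatio, hankelRatio, powRatio, ← mul_div_assoc, ← mul_div_assoc, ← ENNReal.add_div,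
    ← ENNReal.tsum_mul_left, ← ENNReal.tsum_mul_left, ← ENNReal.tsum_add]
  exact ENNReal.div_le_div_right
    (ENNReal.tsum_le_tsum fun i => enorm_mulOp_pow_sub_le hf k hC _) _

lemma powRatio_zero {f : ℂ → ℂ} (hf : MemLp f ∞ iota) (ν : ℕ) : powRatio hf 0 ν = 0 := by
  have h : ∀ i, mulOp (memLp_top_iotaW ν (memLp_top_pow hf 0)) (basis (Hol ν) i) -
      ((toeplitz (memLp_top_iotaW ν hf) ^ 0) (basis (Hol ν) i) : Lp ℂ 2 (iotaW ν)) = 0 := by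
    intro i
    rw [sub_eq_zero]
    refine Lp.ext ?_
    filter_upwards [mulOp_ae_eq (memLp_top_iotaW ν (memLp_top_pow hf 0))
      (basis (Hol ν) i : Lp ℂ 2 (iotaW ν))] with x hx
    rw [hx, pow_zero, one_mul, pow_zero]
    rfl
  simp only [powRatio, h]
  simp

lemma tendsto_powRatio {f : ℂ → ℂ} (hf2 : MemLp f 2 iota) (hf : MemLp f ∞ iota) (k : ℕ) :
    Tendsto (powRatio hf k) atTop (𝓝 0) := by
  induction k with
  | zero =>
    rw [show powRatio hf 0 = fun _ => 0 from funext (powRatio_zero hf)]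
    exact tendsto_const_nhds
  | succ k ih =>
    obtain ⟨C, hC⟩ := exists_ae_bound hf
    have h1 := ENNReal.Tendsto.const_mul (a := 2)
      (tendsto_hankelRatio (memLp_two_pow hf2 hf k) (memLp_top_pow hf (k + 1)))
      (Or.inr (by norm_num))
    have h2 := ENNReal.Tendsto.const_mul (a := 2 * ENNReal.ofReal (C ^ 2)) ih
      (Or.inr (ENNReal.mul_ne_top (by norm_num) ENNReal.ofReal_ne_top))
    have h3 := h1.add h2
    simp only [mul_zero, add_zero] at h3
    exact tendsto_of_tendsto_of_tendsto_of_le_of_le tendsto_const_nhds h3 (fun _ => zero_le)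
      fun ν => powRatio_succ_le hf k (hC ν)

/-! ### The trace of powers -/

/-- A termwise substitute for Cauchy-Schwarz on sums: δ is chosen after summation. The proof
completes the square in ‖a‖. -/
lemma norm_inner_le_weighted {E : Type*} [NormedAddCommGroup E] [InnerProductSpace ℂ E] (a b : E)
    {δ : ℝ} (hδ : 0 < δ) : ‖⟪a, b⟫_ℂ‖ ≤ δ * ‖a‖ ^ 2 + δ⁻¹ * ‖b‖ ^ 2 := by
  have h1 := norm_inner_le_norm (𝕜 := ℂ) a b
  have h2 : δ * ‖a‖ ^ 2 + δ⁻¹ * ‖b‖ ^ 2 - ‖a‖ * ‖b‖ =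
      δ * ((‖a‖ - δ⁻¹ * ‖b‖ / 2) ^ 2) + 3 / 4 * δ⁻¹ * ‖b‖ ^ 2 := by
    field_simp
    ring
  have h3 : 0 ≤ δ * ((‖a‖ - δ⁻¹ * ‖b‖ / 2) ^ 2) + 3 / 4 * δ⁻¹ * ‖b‖ ^ 2 := by positivity
  linarith

/-- Moving one T_f to the left of the inner product as M_{f̄} and replacing T_f^{k+1} by M_{f^{k+1}}
turns the trace into (ν - 1) ∫ f^{k+2} dι minus ∑ ⟨x_i, d_i⟩. Here x has squared norm (ν - 1) ∫ |f|²
dι, while d is the negligible difference. -/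
lemma norm_trace_toeplitz_pow_sub_le {f : ℂ → ℂ} (hf2 : MemLp f 2 iota) (hf : MemLp f ∞ iota)
    (k : ℕ) {ν : ℕ} (hν : 2 ≤ ν) (hfin : powRatio hf (k + 1) ν ≠ ∞) {δ : ℝ} (hδ : 0 < δ) :
    ‖1 / ((ν : ℂ) - 1) * trace (toeplitz (memLp_top_iotaW ν hf) ^ (k + 2)) -
      ∫ z, f z ^ (k + 2) ∂iota‖ ≤
    δ * (∫⁻ z, ‖f z‖ₑ ^ 2 ∂iota).toReal + δ⁻¹ * (powRatio hf (k + 1) ν).toReal := by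
  have h2 : (2 : ℝ) ≤ ν := by exact_mod_cast hν
  have hν1 : (0 : ℝ) < (ν : ℝ) - 1 := by linarith
  set F := memLp_top_iotaW ν hf with hF
  set e := basis (Hol ν) with he
  set x : basisIndex (Hol ν) → Lp ℂ 2 (iotaW ν) := fun i => mulOp (memLp_conj F) (e i) with hx
  set d : basisIndex (Hol ν) → Lp ℂ 2 (iotaW ν) := fun i =>
    mulOp (memLp_top_iotaW ν (memLp_top_pow hf (k + 1))) (e i) -
      ((toeplitz F ^ (k + 1)) (e i) : Lp ℂ 2 (iotaW ν)) with hd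
  have hsum := hasSum_integral_mul_basis hν (integrable_pow hf2 hf k)
  have hpow : ∀ z, f z * f z ^ (k + 1) = f z ^ (k + 2) := fun z => (pow_succ' _ _).symm
  have hfk : MemLp (fun z => f z * f z ^ (k + 1)) ∞ (iotaW ν) := by
    simpa only [hpow] using memLp_top_iotaW ν (memLp_top_pow hf (k + 2))
  have hterm : ∀ i, ∫ z, f z ^ (k + 2) * (conj (toFun (e i) z) * toFun (e i) z) ∂(iotaW ν) =
      ⟪e i, (toeplitz F ^ (k + 2)) (e i)⟫_ℂ + ⟪x i, d i⟫_ℂ := by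
    intro i
    have h3 : ⟪e i, (toeplitz F ^ (k + 2)) (e i)⟫_ℂ =
        ⟪x i, ((toeplitz F ^ (k + 1)) (e i) : Lp ℂ 2 (iotaW ν))⟫_ℂ := by
      rw [pow_succ', mul_apply_eq_comp, inner_toeplitz_right, inner_mulOp_right]
    rw [h3, hd, inner_sub_right, add_sub_cancel, hx, ← inner_mulOp_right F,
      mulOp_mulOp F (memLp_top_iotaW ν (memLp_top_pow hf (k + 1))) hfk, inner_mulOp_right_eq_integral]
    refine integral_congr_ae ?_
    filter_upwards [coe_ae_eq_toFun (e i)] with z hz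
    rw [hz, hpow]
  have hxs : ∑' i, ‖x i‖ₑ ^ 2 = ENNReal.ofReal ((ν : ℝ) - 1) * ∫⁻ z, ‖f z‖ₑ ^ 2 ∂iota := by
    rw [hx, tsum_enorm_mulOp_sq hν]
    simp only [RCLike.enorm_conj]
  have hds : ∑' i, ‖d i‖ₑ ^ 2 = ENNReal.ofReal ((ν : ℝ) - 1) * powRatio hf (k + 1) ν := by
    rw [powRatio, ENNReal.mul_div_cancel (ofReal_sub_one_ne_zero hν) ENNReal.ofReal_ne_top]
  have hxsum : Summable fun i => ‖x i‖ ^ 2 := by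
    rw [summable_norm_sq_iff, hxs]
    exact ENNReal.mul_ne_top ENNReal.ofReal_ne_top (lintegral_enorm_sq_ne_top hf2)
  have hdsum : Summable fun i => ‖d i‖ ^ 2 := by
    rw [summable_norm_sq_iff, hds]
    exact ENNReal.mul_ne_top ENNReal.ofReal_ne_top hfin
  have htsum : ∀ (y : basisIndex (Hol ν) → Lp ℂ 2 (iotaW ν)) (c : ℝ≥0∞),
      (Summable fun i => ‖y i‖ ^ 2) → ∑' i, ‖y i‖ₑ ^ 2 = ENNReal.ofReal ((ν : ℝ) - 1) * c →
      ∑' i, ‖y i‖ ^ 2 = ((ν : ℝ) - 1) * c.toReal := by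
    intro y c hy hyc
    rw [← ofReal_tsum_norm_sq hy] at hyc
    have h4 := congrArg ENNReal.toReal hyc
    rwa [ENNReal.toReal_mul, ENNReal.toReal_ofReal hν1.le,
      ENNReal.toReal_ofReal (tsum_nonneg fun i => by positivity)] at h4
  have hbs := (hxsum.mul_left δ).add (hdsum.mul_left δ⁻¹)
  have hxd : Summable fun i => ⟪x i, d i⟫_ℂ :=
    Summable.of_norm_bounded hbs fun i => norm_inner_le_weighted _ _ hδ
  have hle : ‖∑' i, ⟪x i, d i⟫_ℂ‖ ≤ ((ν : ℝ) - 1) *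
      (δ * (∫⁻ z, ‖f z‖ₑ ^ 2 ∂iota).toReal + δ⁻¹ * (powRatio hf (k + 1) ν).toReal) := by
    refine (tsum_of_norm_bounded hbs.hasSum fun i => norm_inner_le_weighted _ _ hδ).trans
      (le_of_eq ?_)
    rw [(hxsum.mul_left δ).tsum_add (hdsum.mul_left δ⁻¹), tsum_mul_left, tsum_mul_left,
      htsum x _ hxsum hxs, htsum d _ hdsum hds]
    ring
  have htr : trace (toeplitz F ^ (k + 2)) =
      ((ν : ℂ) - 1) * ∫ z, f z ^ (k + 2) ∂iota - ∑' i, ⟪x i, d i⟫_ℂ := by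
    rw [trace_def, ← hsum.tsum_eq, ← hsum.summable.tsum_sub hxd]
    refine tsum_congr fun i => ?_
    rw [hterm i, add_sub_cancel_right]
  have hνc : (ν : ℂ) - 1 ≠ 0 := by
    have : (ν : ℝ) - 1 ≠ 0 := hν1.ne'
    exact_mod_cast this
  have hfinal : 1 / ((ν : ℂ) - 1) * trace (toeplitz F ^ (k + 2)) - ∫ z, f z ^ (k + 2) ∂iota =
      -(((ν : ℂ) - 1)⁻¹ * ∑' i, ⟪x i, d i⟫_ℂ) := by
    rw [htr]
    field_simp
    ring
  have hnorm : ‖((ν : ℂ) - 1)⁻¹‖ = ((ν : ℝ) - 1)⁻¹ := by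
    rw [norm_inv]
    have : (ν : ℂ) - 1 = (((ν : ℝ) - 1 : ℝ) : ℂ) := by push_cast; rfl
    rw [this, Complex.norm_real, Real.norm_of_nonneg hν1.le]
  rw [hfinal, norm_neg, norm_mul, hnorm, inv_mul_le_iff₀ hν1]
  exact hle

lemma tendsto_trace_toeplitz_pow {f : ℂ → ℂ} (hf2 : MemLp f 2 iota) (hf : MemLp f ∞ iota)
    (k : ℕ) :
    Tendsto (fun ν : ℕ => 1 / ((ν : ℂ) - 1) *
      trace (toeplitz (memLp_top_iotaW ν hf) ^ (k + 2))) atTop (𝓝 (∫ z, f z ^ (k + 2) ∂iota)) := by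
  rw [Metric.tendsto_nhds]
  intro ε hε
  set A := (∫⁻ z, ‖f z‖ₑ ^ 2 ∂iota).toReal with hA
  have hA0 : 0 ≤ A := ENNReal.toReal_nonneg
  -- Makes the first error term at most ε/2 for every ν; the `+ 1` covers A = 0. The factor δ⁻¹ is
  -- then fixed while `powRatio` tends to zero.
  set δ := ε / (2 * (A + 1)) with hδ
  have hδ0 : 0 < δ := by positivity
  have h1 := tendsto_powRatio hf2 hf (k + 1)
  have h2 := (ENNReal.tendsto_toReal ENNReal.zero_ne_top).comp h1
  have h3 := h2.const_mul δ⁻¹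
  rw [ENNReal.toReal_zero, mul_zero] at h3
  filter_upwards [h3.eventually_lt_const (half_pos hε), eventually_ge_atTop 2,
    h1.eventually_lt_const ENNReal.zero_lt_top] with ν hν1 hν2 hν3
  rw [dist_eq_norm]
  refine (norm_trace_toeplitz_pow_sub_le hf2 hf k hν2 hν3.ne hδ0).trans_lt ?_
  have h4 : δ * A ≤ ε / 2 := by
    rw [hδ, div_mul_eq_mul_div, div_le_div_iff₀ (by positivity) two_pos]
    nlinarith
  simp only [Function.comp_apply] at hν1
  linarith

/-- The case of powers `m ≥ 2`, for square integrable bounded symbols. -/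
lemma adjointSymbol_pow {f : ℂ → ℂ} (hf2 : MemLp f 2 iota) (hf : MemLp f ∞ iota) {m : ℕ}
    (hm : 2 ≤ m) :
    (∀ ν : ℕ, 2 ≤ ν → IsTraceClass ((((ν : ℂ) - 1) • adjointSymbol ν f) ^ m)) ∧
      Integrable (fun z => f z ^ m) iota ∧
      Tendsto (fun ν : ℕ => 1 / ((ν : ℂ) - 1) *
        trace ((((ν : ℂ) - 1) • adjointSymbol ν f) ^ m)) atTop (𝓝 (∫ z, f z ^ m ∂iota)) := by
  obtain ⟨k, rfl⟩ := Nat.exists_eq_add_of_le' hm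
  refine ⟨fun ν hν => ?_, integrable_pow hf2 hf k, ?_⟩
  · rw [smul_adjointSymbol hν hf2 hf]
    exact isTraceClass_toeplitz_pow hν hf2 _ hm
  · refine (tendsto_trace_toeplitz_pow hf2 hf k).congr' ?_
    filter_upwards [eventually_ge_atTop 2] with ν hν
    rw [smul_adjointSymbol hν hf2 hf]

lemma adjointSymbol_pow_one {f : ℂ → ℂ} (hf1 : Integrable f iota) (hf2 : MemLp f 2 iota)
    (hf : MemLp f ∞ iota) :
    (∀ ν : ℕ, 2 ≤ ν → IsTraceClass ((((ν : ℂ) - 1) • adjointSymbol ν f) ^ 1)) ∧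
      Integrable (fun z => f z ^ 1) iota ∧
      Tendsto (fun ν : ℕ => 1 / ((ν : ℂ) - 1) *
        trace ((((ν : ℂ) - 1) • adjointSymbol ν f) ^ 1)) atTop (𝓝 (∫ z, f z ^ 1 ∂iota)) := by
  simp only [pow_one]
  refine ⟨fun ν hν => ?_, hf1, ?_⟩
  · rw [smul_adjointSymbol hν hf2 hf]
    exact isTraceClass_toeplitz hν hf1 _
  -- By `trace_toeplitz` the normalized trace equals the integral for every ν ≥ 2.
  · refine tendsto_const_nhds.congr' ?_
    filter_upwards [eventually_ge_atTop 2] with ν hν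
    have h2 : (2 : ℝ) ≤ ν := by exact_mod_cast hν
    have hνc : (ν : ℂ) - 1 ≠ 0 := by
      have : (ν : ℝ) - 1 ≠ 0 := by linarith
      exact_mod_cast this
    rw [smul_adjointSymbol hν hf2 hf, trace_toeplitz hν hf1]
    field_simp

/-! ### Continuous symbols with compact support -/

/-- The support lies in a disc of radius R < 1, where ι is finite and f is bounded. -/
lemma memLp_of_hasCompactSupport {f : ℂ → ℂ} (hf : Continuous f) (hfc : HasCompactSupport f)
    (hs : tsupport f ⊆ ball (0 : ℂ) 1) (p : ℝ≥0∞) : MemLp f p iota := by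
  obtain ⟨R, hR, hsub⟩ := exists_lt_subset_ball (isClosed_tsupport f) hs
  have hfin : IsFiniteMeasure (iota.restrict (ball (0 : ℂ) R)) :=
    ⟨by rw [Measure.restrict_apply_univ]; exact iota_ball_lt_top hR⟩
  obtain ⟨C, hC⟩ := hfc.exists_bound_of_continuous hf
  have h1 : (ball (0 : ℂ) R).indicator f = f := by
    rw [Set.indicator_eq_self]
    exact (subset_tsupport f).trans hsub
  rw [← h1, memLp_indicator_iff_restrict measurableSet_ball]
  exact MemLp.of_bound hf.aestronglyMeasurable C (Eventually.of_forall hC)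

end HolDisc

end

/-! ### The main theorem. -/

theorem mainTheorem11 :
    (∀ f : ℂ → ℂ, MemLp f 2 HolDisc.iota → MemLp f ⊤ HolDisc.iota →
      (∀ ν : ℕ, 2 ≤ ν → HolDisc.IsAdjointSymbol f (HolDisc.adjointSymbol ν f)) ∧
      ∀ n : ℕ, 1 ≤ n →
        (∀ ν : ℕ, 2 ≤ ν →
          HolDisc.IsTraceClass ((((ν : ℂ) - 1) • HolDisc.adjointSymbol ν f) ^ (2 * n))) ∧
        Integrable (fun z => f z ^ (2 * n)) HolDisc.iota ∧
        Tendsto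
          (fun ν : ℕ => 1 / ((ν : ℂ) - 1) *
            HolDisc.trace ((((ν : ℂ) - 1) • HolDisc.adjointSymbol ν f) ^ (2 * n)))
          atTop (𝓝 (∫ z, f z ^ (2 * n) ∂HolDisc.iota))) ∧
    (∀ f : ℂ → ℂ, Continuous f → HasCompactSupport f → tsupport f ⊆ ball (0 : ℂ) 1 →
      (∀ ν : ℕ, 2 ≤ ν → HolDisc.IsAdjointSymbol f (HolDisc.adjointSymbol ν f)) ∧
      ∀ n : ℕ, 1 ≤ n →
        (∀ ν : ℕ, 2 ≤ ν →
          HolDisc.IsTraceClass ((((ν : ℂ) - 1) • HolDisc.adjointSymbol ν f) ^ n)) ∧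
        Integrable (fun z => f z ^ n) HolDisc.iota ∧
        Tendsto
          (fun ν : ℕ => 1 / ((ν : ℂ) - 1) *
            HolDisc.trace ((((ν : ℂ) - 1) • HolDisc.adjointSymbol ν f) ^ n))
          atTop (𝓝 (∫ z, f z ^ n ∂HolDisc.iota))) := by
  refine ⟨fun f hf2 hf => ⟨fun ν hν => HolDisc.isAdjointSymbol_adjointSymbol hν hf2 hf,
    fun n hn => HolDisc.adjointSymbol_pow hf2 hf (by omega)⟩, fun f hfc hfs hfb => ?_⟩
  have hf2 := HolDisc.memLp_of_hasCompactSupport hfc hfs hfb 2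
  have hf := HolDisc.memLp_of_hasCompactSupport hfc hfs hfb ⊤
  have hf1 := HolDisc.memLp_of_hasCompactSupport hfc hfs hfb 1
  refine ⟨fun ν hν => HolDisc.isAdjointSymbol_adjointSymbol hν hf2 hf, fun n hn => ?_⟩
  -- Only the first power requires f itself to be integrable; in the first statement the exponent 2n
  -- is at least 2, so square integrability suffices.
  rcases hn.eq_or_lt with rfl | hn
  · exact HolDisc.adjointSymbol_pow_one (memLp_one_iff_integrable.mp hf1) hf2 hf
  · exact HolDisc.adjointSymbol_pow hf2 hf hn
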